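/- Let $(M,\mathbf g)$ be a connected compact $C^\infty$ Riemannian manifold of dimension $N\ge 1$ with smooth (possibly empty) boundary $\partial M$ and outward unit normal $\nu$. Let $\mathrm{meas}_M$ and $\mathrm{meas}_{\partial M}$ be the Riemannian measures of $M$ and of $\partial M$ (counting measure on $\partial M$ if $N=1$). For $\varepsilon>0$ let $\chi_\varepsilon(M)$ be the class of measurable sets $A\subset M$ that are $\varepsilon$-controllable, that is, $$\mathrm{meas}_M(A)+\mathrm{meas}_{\partial M}(A\cap\partial M)<\varepsilon .$$ Then for all $\varepsilon>0$ and $\varepsilon_0\in(0,\varepsilon)$ the following hold. 1. There is an open set $V\subset M$ with smooth boundary $S=\overline{\partial V\cap \mathrm{int}(M)}$ that meets $\partial M$ transversally, such that $\overline{M\setminus V}\in\chi_{\varepsilon_0}(M)$. (That is, near each $p\in S$ there is a smooth function $\varphi$ with $d\varphi_p\neq0$, $V=\{\varphi<0\}$ and $S=\{\varphi=0\}$ near $p$; and if $p\in\partial M$, then $\ker d\varphi_p+T_p\partial M=T_pM$.) 2. For this $V$ there is a function $d:M\to\mathbb R$ such that - (d1) $d\in C^\infty(M)$; - (d2) $\mathrm{Hess}\,d(X,X)\ge|X|_{\mathbf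 g}^2$ for all $X\in T_xM$, $x\in\overline V$; - (d3) $\inf_V|\nabla d|_{\mathbf g}>0$ and $\min_{\overline V}d>0$ (in particular $V\ne\emptyset$); - (d4) $\langle\nabla d,\nu\rangle_{\mathbf g}<0$ on $\partial M\cap\overline V$. 3. For this $V$ there is an open set $\omega\in\chi_\varepsilon(M)$ such that $\overline{M\setminus V}\subset\omega$ and $\omega\cap V\in\chi_{\varepsilon-\varepsilon_0}(M)$. -/

import Mathlib

open scoped Manifold ContDiff
open MeasureTheory

noncomputable section

namespace RiemBdry

/-- The model vector space `ℝ^(n+1)`. -/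
abbrev Vec (n : ℕ) : Type := EuclideanSpace ℝ (Fin (n + 1))

/-- A smooth (up to the boundary) Riemannian metric on a manifold with boundary of dimension
`n + 1`, modelled on the half-space `{y | 0 ≤ y 0}`. -/
abbrev Metric (n : ℕ) (M : Type*) [TopologicalSpace M] [ChartedSpace (EuclideanHalfSpace (n + 1)) M]
    [IsManifold (𝓡∂ (n + 1)) ∞ M] : Type _ :=
  Bundle.ContMDiffRiemannianMetric (𝓡∂ (n + 1)) ∞ (Vec n)
    (fun x : M => TangentSpace (𝓡∂ (n + 1)) x)

variable {n : ℕ} {M : Type*} [TopologicalSpace M] [ChartedSpace (EuclideanHalfSpace (n + 1)) M]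

/-! ### The tangent space of the boundary

`TangentSpace (𝓡∂ (n + 1)) x` is `ℝ^(n+1)`, a tangent vector being given by its coordinates in the
preferred chart at `x`. -/

/-- The zeroth coordinate of a tangent vector in the preferred chart at `x`. At a boundary point it
is positive on the vectors that point inward, negative on those that point outward, and it
vanishes on those tangent to the boundary. -/
def normalCovector (x : M) : TangentSpace (𝓡∂ (n + 1)) x →ₗ[ℝ] ℝ :=
  (EuclideanSpace.proj (𝕜 := ℝ) (0 : Fin (n + 1)) : Vec n →L[ℝ] ℝ).toLinearMap

/-- The tangent space of `∂M` at a boundary point `x`, as a subspace of `T_x M`. -/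
def boundaryTangentSpace (x : M) : Submodule ℝ (TangentSpace (𝓡∂ (n + 1)) x) :=
  LinearMap.ker (normalCovector x)

/-! ### Open sets with smooth boundary that meets `∂M` transversally -/

/-- The part `closure (∂V ∩ int M)` of the boundary of `V`. -/
def innerBoundary (n : ℕ) {M : Type*} [TopologicalSpace M]
    [ChartedSpace (EuclideanHalfSpace (n + 1)) M] (V : Set M) : Set M :=
  closure (frontier V ∩ (𝓡∂ (n + 1)).interior M)

/-- `V` has smooth boundary `S = closure (∂V ∩ int M)`, which meets `∂M` transversally: near each
point `p` of `S` there is a smooth function `φ` with `d φ_p ≠ 0` such that `V` is `{φ < 0}` and `S`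
is `{φ = 0}`, and if `p ∈ ∂M` then `T_p S + T_p ∂M = T_p M`, where `T_p S = ker d φ_p`. -/
def HasSmoothTransversalBoundary (n : ℕ) {M : Type*} [TopologicalSpace M]
    [ChartedSpace (EuclideanHalfSpace (n + 1)) M] (V : Set M) : Prop :=
  ∀ p ∈ innerBoundary n V, ∃ U : Set M, IsOpen U ∧ p ∈ U ∧ ∃ φ : M → ℝ,
    ContMDiffOn (𝓡∂ (n + 1)) 𝓘(ℝ, ℝ) ∞ φ U ∧
    V ∩ U = {q ∈ U | φ q < 0} ∧
    innerBoundary n V ∩ U = {q ∈ U | φ q = 0} ∧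
    mfderiv (𝓡∂ (n + 1)) 𝓘(ℝ, ℝ) φ p ≠ 0 ∧
    (p ∈ (𝓡∂ (n + 1)).boundary M →
      LinearMap.ker (mfderiv (𝓡∂ (n + 1)) 𝓘(ℝ, ℝ) φ p).toLinearMap ⊔
        boundaryTangentSpace p = ⊤)

variable [IsManifold (𝓡∂ (n + 1)) ∞ M]

/-! ### Norm, gradient, Hessian, outward normal -/

/-- The length `|v|_g` of a tangent vector. -/
def tangentNorm (g : Metric n M) {x : M} (v : TangentSpace (𝓡∂ (n + 1)) x) : ℝ :=
  √(g.inner x v v)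

/-- The map `v ↦ g(v, ·)` from `T_x M` to its dual. -/
def flat (g : Metric n M) (x : M) :
    TangentSpace (𝓡∂ (n + 1)) x →ₗ[ℝ] Module.Dual ℝ (TangentSpace (𝓡∂ (n + 1)) x) :=
  LinearMap.mk₂ ℝ (fun v w => g.inner x v w)
    (fun v v' w => by simp) (fun c v w => by simp) (fun v w w' => by simp)
    (fun c v w => by simp)

theorem flat_injective (g : Metric n M) (x : M) : Function.Injective (flat g x) := by
  rw [injective_iff_map_eq_zero]
  intro v hv
  by_contra h
  have h1 := g.pos x v h
  have h2 : g.inner x v v = 0 := by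
    simpa [flat] using LinearMap.congr_fun hv v
  exact h1.ne h2.symm

/-- The vector of `T_x M` that represents a covector `ℓ`, so `g(sharp ℓ, v) = ℓ v`. -/
def sharp (g : Metric n M) (x : M) (l : TangentSpace (𝓡∂ (n + 1)) x →ₗ[ℝ] ℝ) :
    TangentSpace (𝓡∂ (n + 1)) x :=
  haveI : FiniteDimensional ℝ (TangentSpace (𝓡∂ (n + 1)) x) :=
    inferInstanceAs (FiniteDimensional ℝ (Vec n))
  (LinearMap.linearEquivOfInjective (flat g x) (flat_injective g x)
    Subspace.dual_finrank_eq.symm).symm l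

theorem inner_sharp (g : Metric n M) (x : M) (l : TangentSpace (𝓡∂ (n + 1)) x →ₗ[ℝ] ℝ)
    (v : TangentSpace (𝓡∂ (n + 1)) x) : g.inner x (sharp g x l) v = l v := by
  have : FiniteDimensional ℝ (TangentSpace (𝓡∂ (n + 1)) x) :=
    inferInstanceAs (FiniteDimensional ℝ (Vec n))
  have h : flat g x (sharp g x l) = l :=
    (LinearMap.linearEquivOfInjective (flat g x) (flat_injective g x)
      Subspace.dual_finrank_eq.symm).apply_symm_apply l
  exact LinearMap.congr_fun h v

/-- The gradient `∇f` at `x`. -/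
def gradient (g : Metric n M) (f : M → ℝ) (x : M) : TangentSpace (𝓡∂ (n + 1)) x :=
  sharp g x (mfderiv (𝓡∂ (n + 1)) 𝓘(ℝ, ℝ) f x).toLinearMap

/-- The outward unit normal `ν` at a boundary point: the inward normals are the positive multiples
of the vector that represents `normalCovector`. -/
def outwardNormal (g : Metric n M) (x : M) : TangentSpace (𝓡∂ (n + 1)) x :=
  -((tangentNorm g (sharp g x (normalCovector x)))⁻¹ • sharp g x (normalCovector x))

/-- The metric in the coordinates of the chart `φ` at `x`: for `y` in the target of `φ`, this is
`g(dφ⁻¹ v, dφ⁻¹ w)` at the point `φ⁻¹ y`. Derivatives are taken within the half-space. -/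
def chartMetric (g : Metric n M) (x : M) (y v w : Vec n) : ℝ :=
  g.inner ((extChartAt (𝓡∂ (n + 1)) x).symm y)
    (mfderivWithin 𝓘(ℝ, Vec n) (𝓡∂ (n + 1)) (extChartAt (𝓡∂ (n + 1)) x).symm
      (Set.range (𝓡∂ (n + 1))) y v)
    (mfderivWithin 𝓘(ℝ, Vec n) (𝓡∂ (n + 1)) (extChartAt (𝓡∂ (n + 1)) x).symm
      (Set.range (𝓡∂ (n + 1))) y w)

/-- The derivative at `x` of `chartMetric g x · v w` in the direction `u`; on basis vectors this is
`∂_u g_{vw}`. -/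
def chartMetricDeriv (g : Metric n M) (x : M) (u v w : Vec n) : ℝ :=
  fderivWithin ℝ (fun y => chartMetric g x y v w) (Set.range (𝓡∂ (n + 1)))
    (extChartAt (𝓡∂ (n + 1)) x x) u

/-- The Christoffel symbol of the first kind at `x` in the chart at `x`, as a trilinear form:
`g(∇_u v, w)` for the Levi-Civita connection and constant coordinate fields `u, v, w`. -/
def christoffel (g : Metric n M) (x : M) (u v w : Vec n) : ℝ :=
  (chartMetricDeriv g x u v w + chartMetricDeriv g x v u w - chartMetricDeriv g x w u v) / 2

/-- The Hessian of `f` at `x`, `(Hess f)_{ij} = ∂_i ∂_j f - Γ_{ij}^k ∂_k f` in the chart at `x`,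
where `Γ_{ij}^k ∂_k f = Γ_{ij,l} (∇f)^l`. -/
def hessian (g : Metric n M) (f : M → ℝ) (x : M) (X Y : TangentSpace (𝓡∂ (n + 1)) x) : ℝ :=
  fderivWithin ℝ
      (fun y => fderivWithin ℝ (f ∘ (extChartAt (𝓡∂ (n + 1)) x).symm)
        (Set.range (𝓡∂ (n + 1))) y (Y : Vec n))
      (Set.range (𝓡∂ (n + 1))) (extChartAt (𝓡∂ (n + 1)) x x) (X : Vec n)
    - christoffel g x X Y (gradient g f x)

/-! ### The Riemannian measures of `M` and of `∂M` -/

/-- The coordinate vector `∂_i`. -/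
def coordVec (i : Fin (n + 1)) : Vec n := EuclideanSpace.single i 1

/-- `√(det (g_ij))` in the chart at `x`, with `i, j` over all coordinates. -/
def volumeDensity (g : Metric n M) (x : M) (y : Vec n) : ℝ :=
  √(Matrix.of fun i j : Fin (n + 1) => chartMetric g x y (coordVec i) (coordVec j)).det

/-- `√(det (g_ij))` in the chart at `x`, with `i, j` over the coordinates along the boundary. -/
def boundaryDensity (g : Metric n M) (x : M) (y : Vec n) : ℝ :=
  √(Matrix.of fun i j : Fin n => chartMetric g x y (coordVec i.succ) (coordVec j.succ)).det

/-- The inclusion `z ↦ (0, z)` of `ℝ^n` as the boundary of the half-space. -/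
def boundaryIncl (z : EuclideanSpace ℝ (Fin n)) : Vec n :=
  WithLp.toLp 2 (Fin.cons 0 fun i => z i)

variable [MeasurableSpace M]

/-- The Riemannian measure of the domain of the chart at `x`: Lebesgue measure with density
`√(det (g_ij))`, carried to `M` by the chart. -/
def chartVolume (g : Metric n M) (x : M) : Measure M :=
  (((volume : Measure (Vec n)).restrict (extChartAt (𝓡∂ (n + 1)) x).target).withDensity
    fun y => ENNReal.ofReal (volumeDensity g x y)).map (extChartAt (𝓡∂ (n + 1)) x).symm

/-- The Riemannian measure of the part of `∂M` in the domain of the chart at `x`, as a measure on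
`M` (in dimension `n + 1 = 1` it counts boundary points). -/
def chartBoundaryVolume (g : Metric n M) (x : M) : Measure M :=
  (((volume : Measure (EuclideanSpace ℝ (Fin n))).restrict
      (boundaryIncl ⁻¹' (extChartAt (𝓡∂ (n + 1)) x).target)).withDensity
    fun z => ENNReal.ofReal (boundaryDensity g x (boundaryIncl z))).map
      fun z => (extChartAt (𝓡∂ (n + 1)) x).symm (boundaryIncl z)

/-- The Riemannian measure `meas_M`. The local measures `chartVolume g x` agree on overlaps of
charts, so their supremum is the measure on `M` that restricts to each of them. -/
def volumeMeasure (g : Metric n M) : Measure M := ⨆ x : M, chartVolume g x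

/-- The Riemannian measure `meas_∂M` of the boundary, as a measure on `M` carried by `∂M`. -/
def boundaryMeasure (g : Metric n M) : Measure M := ⨆ x : M, chartBoundaryVolume g x

/-- `s` is `ε`-controllable in measure. -/
def Controllable (g : Metric n M) (ε : ℝ) (s : Set M) : Prop :=
  MeasurableSet s ∧
    volumeMeasure g s + boundaryMeasure g (s ∩ (𝓡∂ (n + 1)).boundary M) < ENNReal.ofReal ε

end RiemBdry

end

noncomputable section

namespace RiemBdry

open Set Filter Topology

/-! ### Coordinate changes and the metric in charts -/

section Charts

variable {n : ℕ} {M : Type*} [TopologicalSpace M] [ChartedSpace (EuclideanHalfSpace (n + 1)) M]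

/-! Nothing global is asked of `V`: it need not be connected. It can therefore be a finite disjoint
union of small coordinate balls that fills `M` up to small measure, and the convex function can be
built on each ball separately.

Locally, near a point with coordinates `p`, take `F y = 2 + (y 0 - p 0) + k ‖y - p‖ ^ 2`. A large
`k` makes the Hessian beat both the metric and the Christoffel term. A radius small compared with `1
/ k` keeps `dF` close to `dy 0`, so the gradient does not vanish and, at boundary points, points
inward (`exists_isConvexAt`). The Hessian is defined in a chart that changes with the point, so it
must first be moved to one fixed chart. The second derivatives of the coordinate change cancel
against the Christoffel symbols (`hessian_eq_chartHessian`).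

Each ball is centred on `∂M` or stays away from it. In the first case the sphere is transversal to
`∂M`, because the radial vector at a boundary point is tangent to `∂M` (`isPiece_ball`).

For the covering, put volume and boundary measure into one measure `ν`. It is finite: the chart
measures agree on overlaps by change of variables, so by compactness finitely many chart domains
control their supremum. In one chart the Besicovitch theorem gives countably many disjoint closed
balls that cover almost everything, with radii whose spheres are null, and finitely many of them
suffice up to `δ`. An induction over a finite atlas, which removes at each stage the closed balls
already chosen, gives the family on `M` (`exists_isFamily`).

Disjoint compact balls are separated by smooth cutoffs, so the sum of the cut-off local functions is
`d` (`exists_isConvexAt_biUnion`). The set `ω` comes from outer regularity of `ν`. -/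

theorem mem_range_model {y : Vec n} : y ∈ range (𝓡∂ (n + 1)) ↔ 0 ≤ y 0 := by
  rw [range_modelWithCornersEuclideanHalfSpace]; rfl

theorem mem_frontier_range_model {y : Vec n} : y ∈ frontier (range (𝓡∂ (n + 1))) ↔ y 0 = 0 := by
  rw [frontier_range_modelWithCornersEuclideanHalfSpace]
  exact ⟨fun h => Eq.symm h, fun h => Eq.symm h⟩

theorem nonneg_of_mem_target {x : M} {y : Vec n} (hy : y ∈ (extChartAt (𝓡∂ (n + 1)) x).target) :
    0 ≤ y 0 :=
  mem_range_model.1 (extChartAt_target_subset_range x hy)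

/-- The change of coordinates from the chart at `x` to the chart at `x'`. -/
def transition (x x' : M) : Vec n → Vec n :=
  extChartAt (𝓡∂ (n + 1)) x' ∘ (extChartAt (𝓡∂ (n + 1)) x).symm

/-- The points in the target of the chart at `x` that the chart at `x'` also covers. -/
def overlap (x x' : M) : Set (Vec n) :=
  (extChartAt (𝓡∂ (n + 1)) x).target ∩
    (extChartAt (𝓡∂ (n + 1)) x).symm ⁻¹' (extChartAt (𝓡∂ (n + 1)) x').source

theorem overlap_mem_nhdsWithin {x x' : M} {y : Vec n} (hy : y ∈ overlap x x') :
    overlap x x' ∈ 𝓝[range (𝓡∂ (n + 1))] y := by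
  have h1 := extChartAt_target_mem_nhdsWithin_of_mem hy.1
  refine inter_mem h1 ?_
  have h2 := (continuousOn_extChartAt_symm (I := 𝓡∂ (n + 1)) x _ hy.1).mono_of_mem_nhdsWithin h1
  exact h2 ((isOpen_extChartAt_source (I := 𝓡∂ (n + 1)) x').mem_nhds hy.2)

theorem transition_mem_target {x x' : M} {y : Vec n} (hy : y ∈ overlap x x') :
    transition x x' y ∈ (extChartAt (𝓡∂ (n + 1)) x').target :=
  (extChartAt (𝓡∂ (n + 1)) x').map_source hy.2

theorem symm_transition {x x' : M} {y : Vec n} (hy : y ∈ overlap x x') :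
    (extChartAt (𝓡∂ (n + 1)) x').symm (transition x x' y) = (extChartAt (𝓡∂ (n + 1)) x).symm y :=
  (extChartAt (𝓡∂ (n + 1)) x').left_inv hy.2

theorem transition_mem_overlap {x x' : M} {y : Vec n} (hy : y ∈ overlap x x') :
    transition x x' y ∈ overlap x' x := by
  refine ⟨transition_mem_target hy, ?_⟩
  rw [mem_preimage, symm_transition hy]
  exact (extChartAt (𝓡∂ (n + 1)) x).map_target hy.1

theorem transition_transition {x x' : M} {y : Vec n} (hy : y ∈ overlap x x') :
    transition x' x (transition x x' y) = y := by
  change extChartAt (𝓡∂ (n + 1)) x ((extChartAt (𝓡∂ (n + 1)) x').symm (transition x x' y)) = y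
  rw [symm_transition hy]
  exact (extChartAt (𝓡∂ (n + 1)) x).right_inv hy.1

theorem injOn_transition (x x' : M) : InjOn (transition (n := n) x x') (overlap x x') :=
  fun y hy z hz h => by rw [← transition_transition hy, h, transition_transition hz]

theorem extChartAt_mem_overlap {x x' q : M} (hq : q ∈ (extChartAt (𝓡∂ (n + 1)) x).source)
    (hq' : q ∈ (extChartAt (𝓡∂ (n + 1)) x').source) :
    extChartAt (𝓡∂ (n + 1)) x q ∈ overlap x x' := by
  refine ⟨(extChartAt (𝓡∂ (n + 1)) x).map_source hq, ?_⟩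
  rwa [mem_preimage, (extChartAt (𝓡∂ (n + 1)) x).left_inv hq]

theorem transition_extChartAt {x x' q : M} (hq : q ∈ (extChartAt (𝓡∂ (n + 1)) x).source) :
    transition x x' (extChartAt (𝓡∂ (n + 1)) x q) = extChartAt (𝓡∂ (n + 1)) x' q := by
  rw [transition, Function.comp_apply, (extChartAt (𝓡∂ (n + 1)) x).left_inv hq]

theorem uniqueDiffWithinAt_model {y : Vec n} (hy : y ∈ range (𝓡∂ (n + 1))) :
    UniqueDiffWithinAt ℝ (range (𝓡∂ (n + 1))) y :=
  (𝓡∂ (n + 1)).uniqueDiffOn y hy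

theorem overlap_subset_range (x x' : M) : overlap x x' ⊆ range (𝓡∂ (n + 1)) :=
  fun _ hy => extChartAt_target_subset_range x hy.1

/-- Interior and boundary points can be told apart in every chart. -/
theorem isBoundaryPoint_iff_chart [IsManifold (𝓡∂ (n + 1)) ∞ M] {x q : M}
    (hq : q ∈ (extChartAt (𝓡∂ (n + 1)) x).source) :
    q ∈ (𝓡∂ (n + 1)).boundary M ↔ extChartAt (𝓡∂ (n + 1)) x q 0 = 0 := by
  have : IsManifold (𝓡∂ (n + 1)) 1 M := IsManifold.of_le (n := ∞) (by simp)
  have hs : q ∈ (chartAt (EuclideanHalfSpace (n + 1)) x).source := by simpa using hq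
  have h := (𝓡∂ (n + 1)).isInteriorPoint_iff_of_mem_atlas (n := 1) one_ne_zero
    (chart_mem_atlas (EuclideanHalfSpace (n + 1)) x) hs
  have hint : extChartAt (𝓡∂ (n + 1)) x q ∈ interior (extChartAt (𝓡∂ (n + 1)) x).target ↔
      extChartAt (𝓡∂ (n + 1)) x q ∈ interior (range (𝓡∂ (n + 1))) := by
    constructor
    · exact fun h => interior_mono (extChartAt_target_subset_range x) h
    · exact fun h => (chartAt (EuclideanHalfSpace (n + 1)) x).mem_interior_extend_target
        ((chartAt _ x).map_source hs) h
  have hr : extChartAt (𝓡∂ (n + 1)) x q ∈ range (𝓡∂ (n + 1)) :=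
    extChartAt_target_subset_range x ((extChartAt (𝓡∂ (n + 1)) x).map_source hq)
  rw [← mem_frontier_range_model, ← not_iff_not, ← mem_interior_iff_notMem_frontier hr, ← hint]
  rw [← ModelWithCorners.compl_interior, notMem_compl_iff]
  exact h

variable [IsManifold (𝓡∂ (n + 1)) ∞ M]

theorem contDiffWithinAt_transition {x x' : M} {y : Vec n} (hy : y ∈ overlap x x') :
    ContDiffWithinAt ℝ ∞ (transition x x') (range (𝓡∂ (n + 1))) y := by
  have := contDiffWithinAt_ext_coord_change (I := 𝓡∂ (n + 1)) (n := ∞) x' x (y := y)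
    (by rw [PartialEquiv.trans_source]; exact hy)
  exact this

theorem differentiableWithinAt_transition {x x' : M} {y : Vec n} (hy : y ∈ overlap x x') :
    DifferentiableWithinAt ℝ (transition x x') (range (𝓡∂ (n + 1))) y :=
  (contDiffWithinAt_transition hy).differentiableWithinAt (by simp)

theorem tendsto_transition {x x' : M} {y : Vec n} (hy : y ∈ overlap x x') :
    Tendsto (transition x x') (𝓝[range (𝓡∂ (n + 1))] y)
      (𝓝[range (𝓡∂ (n + 1))] (transition x x' y)) := by
  refine tendsto_nhdsWithin_iff.2 ⟨(differentiableWithinAt_transition hy).continuousWithinAt, ?_⟩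
  filter_upwards [overlap_mem_nhdsWithin hy] with z hz
  exact extChartAt_target_subset_range x' (transition_mem_target hz)

theorem mdifferentiableWithinAt_symm {x : M} {y : Vec n}
    (hy : y ∈ (extChartAt (𝓡∂ (n + 1)) x).target) :
    MDifferentiableWithinAt 𝓘(ℝ, Vec n) (𝓡∂ (n + 1)) (extChartAt (𝓡∂ (n + 1)) x).symm
      (range (𝓡∂ (n + 1))) y := by
  have : IsManifold (𝓡∂ (n + 1)) 1 M := IsManifold.of_le (n := ∞) (by simp)
  exact mdifferentiableWithinAt_extChartAt_symm hy

/-- The vector of `T_q M` with coordinates `v` in the chart at `x`, for `q` the point with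
coordinates `y`. -/
def frame (x : M) (y : Vec n) :
    Vec n →L[ℝ] TangentSpace (𝓡∂ (n + 1)) ((extChartAt (𝓡∂ (n + 1)) x).symm y) :=
  mfderivWithin 𝓘(ℝ, Vec n) (𝓡∂ (n + 1)) (extChartAt (𝓡∂ (n + 1)) x).symm
      (range (𝓡∂ (n + 1))) y

theorem frame_transition {x x' : M} {y : Vec n} (hy : y ∈ overlap x x') (v : Vec n) :
    (frame x y v : Vec n) = frame x' (transition x x' y)
      (fderivWithin ℝ (transition x x') (range (𝓡∂ (n + 1))) y v) := by
  have hr := overlap_subset_range x x' hy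
  have h1 : mfderivWithin 𝓘(ℝ, Vec n) (𝓡∂ (n + 1))
      ((extChartAt (𝓡∂ (n + 1)) x').symm ∘ transition x x') (range (𝓡∂ (n + 1))) y =
      mfderivWithin 𝓘(ℝ, Vec n) (𝓡∂ (n + 1)) (extChartAt (𝓡∂ (n + 1)) x').symm
        (range (𝓡∂ (n + 1))) (transition x x' y) ∘L
      mfderivWithin 𝓘(ℝ, Vec n) 𝓘(ℝ, Vec n) (transition x x') (range (𝓡∂ (n + 1))) y := by
    refine mfderivWithin_comp_of_preimage_mem_nhdsWithin (u := range (𝓡∂ (n + 1))) y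
      (mdifferentiableWithinAt_symm (transition_mem_target hy))
      (differentiableWithinAt_transition hy).mdifferentiableWithinAt ?_
      (uniqueDiffWithinAt_model hr).uniqueMDiffWithinAt
    filter_upwards [overlap_mem_nhdsWithin hy] with z hz
    exact extChartAt_target_subset_range x' (transition_mem_target hz)
  have h2 : ((extChartAt (𝓡∂ (n + 1)) x').symm ∘ transition x x')
      =ᶠ[𝓝[range (𝓡∂ (n + 1))] y] (extChartAt (𝓡∂ (n + 1)) x).symm := by
    filter_upwards [overlap_mem_nhdsWithin hy] with z hz using symm_transition hz
  have h3 := h2.mfderivWithin_eq (I := 𝓘(ℝ, Vec n)) (I' := 𝓡∂ (n + 1)) (symm_transition hy)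
  rw [h1, mfderivWithin_eq_fderivWithin] at h3
  exact (DFunLike.congr_fun h3 v).symm

/-- Tangent vectors at `q` are by convention their coordinates in the preferred chart at `q`, so
this frame is the identity. -/
theorem frame_self (q : M) (v : Vec n) :
    (frame q (extChartAt (𝓡∂ (n + 1)) q q) v : Vec n) = v := by
  have : IsManifold (𝓡∂ (n + 1)) 1 M := IsManifold.of_le (n := ∞) (by simp)
  exact DFunLike.congr_fun (mfderivWithin_range_extChartAt_symm (I := 𝓡∂ (n + 1)) (x := q)) v

theorem frame_eq_fderivWithin_transition {x q : M}
    (hq : q ∈ (extChartAt (𝓡∂ (n + 1)) x).source) (v : Vec n) :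
    (frame x (extChartAt (𝓡∂ (n + 1)) x q) v : Vec n) =
      fderivWithin ℝ (transition x q) (range (𝓡∂ (n + 1))) (extChartAt (𝓡∂ (n + 1)) x q) v := by
  rw [frame_transition (extChartAt_mem_overlap hq (mem_extChartAt_source q))]
  rw [transition_extChartAt hq, frame_self]

theorem fderivWithin_transition_comp {x x' : M} {y : Vec n} (hy : y ∈ overlap x x') (v : Vec n) :
    fderivWithin ℝ (transition x' x) (range (𝓡∂ (n + 1))) (transition x x' y)
      (fderivWithin ℝ (transition x x') (range (𝓡∂ (n + 1))) y v) = v := by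
  have hr := overlap_subset_range x x' hy
  have h1 : HasFDerivWithinAt (transition x' x ∘ transition x x') _ (range (𝓡∂ (n + 1))) y :=
    (differentiableWithinAt_transition
      (transition_mem_overlap hy)).hasFDerivWithinAt.comp_of_tendsto y
    (differentiableWithinAt_transition hy).hasFDerivWithinAt (tendsto_transition hy)
  have h2 : HasFDerivWithinAt (transition x' x ∘ transition x x') (ContinuousLinearMap.id ℝ (Vec n))
      (range (𝓡∂ (n + 1))) y := by
    refine (hasFDerivWithinAt_id y _).congr_of_eventuallyEq ?_ (transition_transition hy)
    filter_upwards [overlap_mem_nhdsWithin hy] with z hz using transition_transition hz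
  exact DFunLike.congr_fun ((uniqueDiffWithinAt_model hr).eq h1 h2) v

/-- All tangent spaces are the same type `Vec n` by definition. Vectors over equal but not
syntactically identical base points can thus be compared without casts. -/
theorem inner_congr (g : Metric n M) {p p' : M} (h : p = p') {v w v' w' : Vec n} (hv : v = v')
    (hw : w = w') : g.inner p v w = g.inner p' v' w' := by
  subst h hv hw; rfl

theorem chartMetric_transition (g : Metric n M) {x x' : M} {y : Vec n} (hy : y ∈ overlap x x')
    (v w : Vec n) :
    chartMetric g x y v w = chartMetric g x' (transition x x' y)
      (fderivWithin ℝ (transition x x') (range (𝓡∂ (n + 1))) y v)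
      (fderivWithin ℝ (transition x x') (range (𝓡∂ (n + 1))) y w) :=
  inner_congr g (symm_transition hy).symm (frame_transition hy v) (frame_transition hy w)

/-- The metric in the chart at `x`, as a bilinear form that depends on the coordinates. -/
def gramForm (g : Metric n M) (x : M) (y : Vec n) : Vec n →L[ℝ] Vec n →L[ℝ] ℝ :=
  ContinuousLinearMap.bilinearComp (E := Vec n) (F := Vec n) (G := ℝ)
    (show Vec n →L[ℝ] Vec n →L[ℝ] ℝ from g.inner ((extChartAt (𝓡∂ (n + 1)) x).symm y))
    (show Vec n →L[ℝ] Vec n from frame x y) (show Vec n →L[ℝ] Vec n from frame x y)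

theorem gramForm_apply (g : Metric n M) (x : M) (y v w : Vec n) :
    gramForm g x y v w = chartMetric g x y v w := rfl

/-- The section is constant in the trivialization over the chart at `x`. On the chart domain it is
the coordinate field `frame x · v`, which is how smoothness of `g` becomes smoothness of its
coefficients. -/
theorem contMDiffOn_frame (x : M) (v : Vec n) :
    ContMDiffOn (𝓡∂ (n + 1)) ((𝓡∂ (n + 1)).prod 𝓘(ℝ, Vec n)) ∞
      (fun q => Bundle.TotalSpace.mk' (Vec n) (E := fun q : M => TangentSpace (𝓡∂ (n + 1)) q) q
        ((trivializationAt (Vec n) (TangentSpace (𝓡∂ (n + 1))) x).symmL ℝ q v))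
      (extChartAt (𝓡∂ (n + 1)) x).source := by
  have h := (trivializationAt (Vec n)
    (TangentSpace (𝓡∂ (n + 1)) : M → Type _) x).contMDiffOn_section_baseSet_iff
      (IB := 𝓡∂ (n + 1)) (n := ∞)
      (s := fun q => (trivializationAt (Vec n) (TangentSpace (𝓡∂ (n + 1))) x).symmL ℝ q v)
  have hs : (extChartAt (𝓡∂ (n + 1)) x).source = (trivializationAt (Vec n)
    (TangentSpace (𝓡∂ (n + 1)) : M → Type _) x).baseSet := by simp
  rw [hs]
  refine h.2 ((contMDiffOn_const (c := v)).congr fun q hq => ?_)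
  rw [Bundle.Trivialization.symmL_apply _ hq]
  exact congrArg Prod.snd
    ((trivializationAt (Vec n) (TangentSpace (𝓡∂ (n + 1)) : M → Type _) x).apply_mk_symm hq v)

theorem contDiffOn_chartMetric (g : Metric n M) (x : M) (v w : Vec n) :
    ContDiffOn ℝ ∞ (fun y => chartMetric g x y v w) (extChartAt (𝓡∂ (n + 1)) x).target := by
  have : IsManifold (𝓡∂ (n + 1)) 1 M := IsManifold.of_le (n := ∞) (by simp)
  have h1 : ContMDiffOn (𝓡∂ (n + 1)) 𝓘(ℝ, ℝ) ∞
      (fun q : M => g.inner q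
        ((trivializationAt (Vec n) (TangentSpace (𝓡∂ (n + 1))) x).symmL ℝ q v)
        ((trivializationAt (Vec n) (TangentSpace (𝓡∂ (n + 1))) x).symmL ℝ q w))
      (extChartAt (𝓡∂ (n + 1)) x).source := by
    intro q hq
    have h : ContMDiffWithinAt (𝓡∂ (n + 1)) ((𝓡∂ (n + 1)).prod 𝓘(ℝ)) ∞
        (fun q : M => Bundle.TotalSpace.mk' ℝ (E := Bundle.Trivial M ℝ) q (g.inner q
          ((trivializationAt (Vec n) (TangentSpace (𝓡∂ (n + 1))) x).symmL ℝ q v)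
          ((trivializationAt (Vec n) (TangentSpace (𝓡∂ (n + 1))) x).symmL ℝ q w)))
        (extChartAt (𝓡∂ (n + 1)) x).source q :=
      ContMDiffWithinAt.clm_bundle_apply₂ (F₁ := Vec n) (F₂ := Vec n)
        g.contMDiff.contMDiffAt.contMDiffWithinAt (contMDiffOn_frame x v q hq)
        (contMDiffOn_frame x w q hq)
    exact (Bundle.contMDiffWithinAt_totalSpace.1 h).2
  have h2 := h1.comp (contMDiffOn_extChartAt_symm (I := 𝓡∂ (n + 1)) (n := ∞) x)
    (fun y hy => (extChartAt (𝓡∂ (n + 1)) x).map_target hy)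
  refine (contMDiffOn_iff_contDiffOn.1 h2).congr fun y hy => ?_
  have hs : (extChartAt (𝓡∂ (n + 1)) x).symm y ∈
      (chartAt (EuclideanHalfSpace (n + 1)) x).source := by
    simpa using (extChartAt (𝓡∂ (n + 1)) x).map_target hy
  have h3 := TangentBundle.symmL_trivializationAt (I := 𝓡∂ (n + 1)) (𝕜 := ℝ) hs
  rw [(extChartAt (𝓡∂ (n + 1)) x).right_inv hy] at h3
  have h4 (v : Vec n) := DFunLike.congr_fun h3 v
  exact inner_congr g rfl (h4 v).symm (h4 w).symm

theorem contDiffOn_gramForm (g : Metric n M) (x : M) :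
    ContDiffOn ℝ ∞ (gramForm g x) (extChartAt (𝓡∂ (n + 1)) x).target :=
  contDiffOn_clm_apply.2 fun v => contDiffOn_clm_apply.2 fun w => contDiffOn_chartMetric g x v w

theorem contDiffWithinAt_gramForm (g : Metric n M) {x : M} {y : Vec n}
    (hy : y ∈ (extChartAt (𝓡∂ (n + 1)) x).target) :
    ContDiffWithinAt ℝ ∞ (gramForm g x) (range (𝓡∂ (n + 1))) y :=
  (contDiffOn_gramForm g x y hy).mono_of_mem_nhdsWithin (extChartAt_target_mem_nhdsWithin_of_mem hy)

theorem mfderiv_frame {f : M → ℝ} {x q : M} (hq : q ∈ (extChartAt (𝓡∂ (n + 1)) x).source)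
    (hf : MDifferentiableAt (𝓡∂ (n + 1)) 𝓘(ℝ, ℝ) f q) (v : Vec n) :
    mfderiv (𝓡∂ (n + 1)) 𝓘(ℝ, ℝ) f q (frame x (extChartAt (𝓡∂ (n + 1)) x q) v : Vec n) =
      fderivWithin ℝ (f ∘ (extChartAt (𝓡∂ (n + 1)) x).symm) (range (𝓡∂ (n + 1)))
        (extChartAt (𝓡∂ (n + 1)) x q) v := by
  have hy := (extChartAt (𝓡∂ (n + 1)) x).map_source hq
  have hl := (extChartAt (𝓡∂ (n + 1)) x).left_inv hq
  have h := mfderiv_comp_mfderivWithin_of_eq hf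
    (mdifferentiableWithinAt_symm hy)
    (uniqueDiffWithinAt_model (extChartAt_target_subset_range x hy)).uniqueMDiffWithinAt hl
  rw [mfderivWithin_eq_fderivWithin] at h
  have h2 := DFunLike.congr_fun h v
  exact h2.symm

theorem exists_frame_eq {x q : M} (hq : q ∈ (extChartAt (𝓡∂ (n + 1)) x).source) (w : Vec n) :
    ∃ v : Vec n, (frame x (extChartAt (𝓡∂ (n + 1)) x q) v : Vec n) = w := by
  have ho := extChartAt_mem_overlap (mem_extChartAt_source q) hq
  refine ⟨fderivWithin ℝ (transition q x) (range (𝓡∂ (n + 1))) (extChartAt (𝓡∂ (n + 1)) q q) w, ?_⟩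
  rw [frame_eq_fderivWithin_transition hq, ← transition_extChartAt (mem_extChartAt_source q)]
  exact fderivWithin_transition_comp ho w

theorem inner_frame (g : Metric n M) {x q : M} (hq : q ∈ (extChartAt (𝓡∂ (n + 1)) x).source)
    (v w : Vec n) :
    g.inner q (frame x (extChartAt (𝓡∂ (n + 1)) x q) v : Vec n)
      (frame x (extChartAt (𝓡∂ (n + 1)) x q) w : Vec n) =
    gramForm g x (extChartAt (𝓡∂ (n + 1)) x q) v w :=
  inner_congr g ((extChartAt (𝓡∂ (n + 1)) x).left_inv hq).symm rfl rfl

/-- The first coordinate of a change of coordinates has a derivative that is nonnegative on the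
vectors that point into the half-space. -/
theorem fderivWithin_transition_zero_nonneg {x x' : M} {y : Vec n} (hy : y ∈ overlap x x')
    (h0 : transition x x' y 0 = 0) {v : Vec n} (hv : 0 ≤ v 0) :
    0 ≤ fderivWithin ℝ (transition x x') (range (𝓡∂ (n + 1))) y v 0 := by
  have hr := overlap_subset_range x x' hy
  let P : Vec n →L[ℝ] ℝ := EuclideanSpace.proj 0
  have hd : HasFDerivWithinAt (fun z => P (transition x x' z)) _ (range (𝓡∂ (n + 1))) y :=
    P.hasFDerivAt.comp_hasFDerivWithinAt y (differentiableWithinAt_transition hy).hasFDerivWithinAt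
  -- The zeroth coordinate of the image is nonnegative and vanishes at `y`, so `y` is a minimum and
  -- the one-sided derivatives are nonnegative.
  have hmin : IsLocalMinOn (fun z => P (transition x x' z)) (range (𝓡∂ (n + 1))) y := by
    filter_upwards [overlap_mem_nhdsWithin hy] with z hz
    have : P (transition x x' y) = 0 := h0
    rw [this]
    exact nonneg_of_mem_target (transition_mem_target hz)
  refine hmin.hasFDerivWithinAt_nonneg hd ?_
  refine mem_posTangentConeAt_of_segment_subset ?_
  intro z hz
  rw [segment_eq_image'] at hz
  obtain ⟨t, ht, rfl⟩ := hz
  rw [mem_range_model] at hr ⊢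
  have := mul_nonneg ht.1 hv
  simpa using add_nonneg hr this

theorem fderivWithin_transition_tangent {x x' : M} {y : Vec n} (hy : y ∈ overlap x x')
    (h0 : transition x x' y 0 = 0) {v : Vec n} (hv : v 0 = 0) :
    fderivWithin ℝ (transition x x') (range (𝓡∂ (n + 1))) y v 0 = 0 := by
  refine le_antisymm ?_ (fderivWithin_transition_zero_nonneg hy h0 hv.ge)
  have := fderivWithin_transition_zero_nonneg hy h0 (v := -v) (by simp [hv])
  simpa using this

theorem transition_zero_eq_zero {x x' : M} {y : Vec n} (hy : y ∈ overlap x x') (h0 : y 0 = 0) :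
    transition x x' y 0 = 0 := by
  have hq := (extChartAt (𝓡∂ (n + 1)) x).map_target hy.1
  have := (isBoundaryPoint_iff_chart hq).2
    (by rwa [(extChartAt (𝓡∂ (n + 1)) x).right_inv hy.1])
  exact (isBoundaryPoint_iff_chart hy.2).1 this

/-- At a boundary point, the first coordinate in any chart is a positive multiple of
`normalCovector`. -/
theorem exists_normalCovector_frame {x q : M} (hq : q ∈ (extChartAt (𝓡∂ (n + 1)) x).source)
    (hb : q ∈ (𝓡∂ (n + 1)).boundary M) :
    ∃ c > 0, ∀ v : Vec n,
      normalCovector q (frame x (extChartAt (𝓡∂ (n + 1)) x q) v : Vec n) = c * v 0 := by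
  have ho := extChartAt_mem_overlap hq (mem_extChartAt_source q)
  have h0 := transition_zero_eq_zero ho ((isBoundaryPoint_iff_chart hq).1 hb)
  have h0' := (isBoundaryPoint_iff_chart hq).1 hb
  set y := extChartAt (𝓡∂ (n + 1)) x q
  set D := fderivWithin ℝ (transition x q) (range (𝓡∂ (n + 1))) y with hD
  have hc (v : Vec n) : D v 0 = D (EuclideanSpace.single 0 1) 0 * v 0 := by
    have h := fderivWithin_transition_tangent ho h0
      (v := v - v 0 • EuclideanSpace.single 0 1) (by simp)
    rw [← hD, map_sub, map_smul] at h
    simp only [PiLp.sub_apply, PiLp.smul_apply, smul_eq_mul] at h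
    linarith
  refine ⟨D (EuclideanSpace.single 0 1) 0, lt_of_le_of_ne ?_ ?_, fun v => ?_⟩
  · exact fderivWithin_transition_zero_nonneg ho h0 (by simp)
  -- If the factor were zero, `D` would send the inward vector `e 0` to a tangent one; the inverse
  -- derivative preserves tangency, so `e 0` itself would be tangent.
  · intro hz
    have h1 := fderivWithin_transition_tangent (transition_mem_overlap ho)
      (by rw [transition_transition ho, h0']) (v := D (EuclideanSpace.single 0 1)) hz.symm
    rw [fderivWithin_transition_comp ho] at h1
    simp at h1
  · rw [← hc]
    have := frame_eq_fderivWithin_transition hq v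
    exact congrArg (fun w : Vec n => w 0) this

end Charts

/-! ### Transformation laws for Christoffel symbols and second derivatives -/

section Euclidean

variable {E : Type*} [NormedAddCommGroup E] [NormedSpace ℝ E]

/-- The Christoffel symbol of the first kind of a field `G` of bilinear forms on `s`. -/
def christoffelWithin (s : Set E) (G : E → E →L[ℝ] E →L[ℝ] ℝ) (y u v w : E) : ℝ :=
  (fderivWithin ℝ G s y u v w + fderivWithin ℝ G s y v u w - fderivWithin ℝ G s y w u v) / 2

theorem fderivWithin_pullback {s : Set E} {G G' : E → E →L[ℝ] E →L[ℝ] ℝ} {τ : E → E} {y : E}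
    (hs : UniqueDiffWithinAt ℝ s y) (hy : y ∈ s)
    (hτ : DifferentiableWithinAt ℝ τ s y) (hts : Tendsto τ (𝓝[s] y) (𝓝[s] (τ y)))
    (hτ' : DifferentiableWithinAt ℝ (fderivWithin ℝ τ s) s y)
    (hG : DifferentiableWithinAt ℝ G s y)
    (hG' : DifferentiableWithinAt ℝ G' s (τ y))
    (h : ∀ᶠ z in 𝓝[s] y, ∀ v w, G z v w = G' (τ z) (fderivWithin ℝ τ s z v)
      (fderivWithin ℝ τ s z w)) (u v w : E) :
    fderivWithin ℝ G s y u v w =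
      fderivWithin ℝ G' s (τ y) (fderivWithin ℝ τ s y u) (fderivWithin ℝ τ s y v)
        (fderivWithin ℝ τ s y w) +
      G' (τ y) (fderivWithin ℝ (fderivWithin ℝ τ s) s y u v) (fderivWithin ℝ τ s y w) +
      G' (τ y) (fderivWithin ℝ τ s y v) (fderivWithin ℝ (fderivWithin ℝ τ s) s y u w) := by
  have h1 := ((hG.hasFDerivWithinAt.clm_apply (hasFDerivWithinAt_const v y s)).clm_apply
    (hasFDerivWithinAt_const w y s))
  have hD (v : E) := hτ'.hasFDerivWithinAt.clm_apply (hasFDerivWithinAt_const v y s)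
  have hc : HasFDerivWithinAt (G' ∘ τ)
      ((fderivWithin ℝ G' s (τ y)).comp (fderivWithin ℝ τ s y)) s y :=
    HasFDerivWithinAt.comp_of_tendsto (g := G') y hG'.hasFDerivWithinAt hτ.hasFDerivWithinAt hts
  have h2 := (hc.clm_apply (hD v)).clm_apply (hD w)
  have h3 := h2.congr_of_eventuallyEq (f₁ := fun z => G z v w)
    (by filter_upwards [h] with z hz using hz v w) (h.self_of_nhdsWithin hy v w)
  have h4 := DFunLike.congr_fun (hs.eq h1 h3) u
  simp at h4
  rw [h4]
  ring

/-- Each of the three derivatives of `G` contributes two terms with `D²τ`. By symmetry of `D²τ` and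
of `G'` four of the six cancel, and the other two are equal. -/
theorem christoffelWithin_pullback {s : Set E} {G G' : E → E →L[ℝ] E →L[ℝ] ℝ} {τ : E → E} {y : E}
    (hs : UniqueDiffWithinAt ℝ s y) (hy : y ∈ s)
    (hτ : DifferentiableWithinAt ℝ τ s y) (hts : Tendsto τ (𝓝[s] y) (𝓝[s] (τ y)))
    (hτ' : DifferentiableWithinAt ℝ (fderivWithin ℝ τ s) s y)
    (hsymm : IsSymmSndFDerivWithinAt ℝ τ s y)
    (hG : DifferentiableWithinAt ℝ G s y)
    (hG' : DifferentiableWithinAt ℝ G' s (τ y))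
    (hGsymm : ∀ v w, G' (τ y) v w = G' (τ y) w v)
    (h : ∀ᶠ z in 𝓝[s] y, ∀ v w, G z v w = G' (τ z) (fderivWithin ℝ τ s z v)
      (fderivWithin ℝ τ s z w)) (u v w : E) :
    christoffelWithin s G y u v w =
      christoffelWithin s G' (τ y) (fderivWithin ℝ τ s y u) (fderivWithin ℝ τ s y v)
        (fderivWithin ℝ τ s y w) +
      G' (τ y) (fderivWithin ℝ (fderivWithin ℝ τ s) s y u v) (fderivWithin ℝ τ s y w) := by
  simp only [christoffelWithin, fderivWithin_pullback hs hy hτ hts hτ' hG hG' h]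
  rw [hsymm.eq v u, hsymm.eq w u, hsymm.eq w v,
    hGsymm (fderivWithin ℝ τ s y v) (fderivWithin ℝ (fderivWithin ℝ τ s) s y u w),
    hGsymm (fderivWithin ℝ τ s y u) (fderivWithin ℝ (fderivWithin ℝ τ s) s y v w)]
  ring

theorem fderivWithin_fderivWithin_comp {s : Set E} {F F' : E → ℝ} {τ : E → E} {y : E}
    (hs : UniqueDiffOn ℝ s) (hy : y ∈ s)
    (hτ : ∀ᶠ z in 𝓝[s] y, DifferentiableWithinAt ℝ τ s z)
    (hts : ∀ᶠ z in 𝓝[s] y, Tendsto τ (𝓝[s] z) (𝓝[s] (τ z)))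
    (hτ' : DifferentiableWithinAt ℝ (fderivWithin ℝ τ s) s y)
    (hF : ∀ᶠ z in 𝓝[s] (τ y), DifferentiableWithinAt ℝ F' s z)
    (hF' : DifferentiableWithinAt ℝ (fderivWithin ℝ F' s) s (τ y))
    (h : F =ᶠ[𝓝[s] y] F' ∘ τ) (u v : E) :
    fderivWithin ℝ (fderivWithin ℝ F s) s y u v =
      fderivWithin ℝ (fderivWithin ℝ F' s) s (τ y) (fderivWithin ℝ τ s y u)
        (fderivWithin ℝ τ s y v) +
      fderivWithin ℝ F' s (τ y) (fderivWithin ℝ (fderivWithin ℝ τ s) s y u v) := by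
  have h1 : fderivWithin ℝ F s =ᶠ[𝓝[s] y]
      fun z => (fderivWithin ℝ F' s (τ z)).comp (fderivWithin ℝ τ s z) := by
    filter_upwards [hτ, hts, (hts.self_of_nhdsWithin hy).eventually hF,
      eventually_eventually_nhdsWithin.2 h, self_mem_nhdsWithin] with z h1 h2 h3 h4 hz
    rw [Filter.EventuallyEq.fderivWithin_eq h4 (h4.self_of_nhdsWithin hz)]
    exact (h3.hasFDerivWithinAt.comp_of_tendsto z h1.hasFDerivWithinAt h2).fderivWithin (hs z hz)
  have h2 := (hF'.hasFDerivWithinAt.comp_of_tendsto y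
    (hτ.self_of_nhdsWithin hy).hasFDerivWithinAt (hts.self_of_nhdsWithin hy)).clm_comp
      hτ'.hasFDerivWithinAt
  rw [h1.fderivWithin_eq (h1.self_of_nhdsWithin hy)]
  have h3 := h2.fderivWithin (hs y hy)
  simp only [Function.comp_apply] at h3
  erw [h3]
  simp
  ring

end Euclidean

/-! ### Chart independence of the Hessian -/

section Hessian

variable {n : ℕ} {M : Type*} [TopologicalSpace M] [ChartedSpace (EuclideanHalfSpace (n + 1)) M]
  [IsManifold (𝓡∂ (n + 1)) ∞ M]

theorem gramForm_symm (g : Metric n M) (x : M) (y v w : Vec n) :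
    gramForm g x y v w = gramForm g x y w v :=
  g.symm _ _ _

theorem contDiffWithinAt_comp_symm {f : M → ℝ} {x q : M} {k : ℕ∞ω}
    (hq : q ∈ (extChartAt (𝓡∂ (n + 1)) x).source)
    (hf : ContMDiffAt (𝓡∂ (n + 1)) 𝓘(ℝ, ℝ) k f q) (hk : k ≤ ∞) :
    ContDiffWithinAt ℝ k (f ∘ (extChartAt (𝓡∂ (n + 1)) x).symm) (range (𝓡∂ (n + 1)))
      (extChartAt (𝓡∂ (n + 1)) x q) := by
  have hy := (extChartAt (𝓡∂ (n + 1)) x).map_source hq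
  have hl := (extChartAt (𝓡∂ (n + 1)) x).left_inv hq
  have h1 : ContMDiffWithinAt 𝓘(ℝ, Vec n) (𝓡∂ (n + 1)) k (extChartAt (𝓡∂ (n + 1)) x).symm
      (range (𝓡∂ (n + 1))) (extChartAt (𝓡∂ (n + 1)) x q) :=
    ((contMDiffOn_extChartAt_symm (I := 𝓡∂ (n + 1)) (n := ∞) x _ hy).of_le hk).mono_of_mem_nhdsWithin
      (extChartAt_target_mem_nhdsWithin_of_mem hy)
  exact (hf.comp_contMDiffWithinAt_of_eq h1 hl).contDiffWithinAt

/-- The Hessian of `f` in the chart at `x`, with `grad` for the gradient in that chart. -/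
def chartHessian (g : Metric n M) (x : M) (f : M → ℝ) (y u v grad : Vec n) : ℝ :=
  fderivWithin ℝ (fderivWithin ℝ (f ∘ (extChartAt (𝓡∂ (n + 1)) x).symm) (range (𝓡∂ (n + 1))))
    (range (𝓡∂ (n + 1))) y u v - christoffelWithin (range (𝓡∂ (n + 1))) (gramForm g x) y u v grad

theorem chartMetricDeriv_eq (g : Metric n M) (q : M) (u v w : Vec n) :
    chartMetricDeriv g q u v w = fderivWithin ℝ (gramForm g q) (range (𝓡∂ (n + 1)))
      (extChartAt (𝓡∂ (n + 1)) q q) u v w := by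
  have hy := mem_extChartAt_target (I := 𝓡∂ (n + 1)) q
  have hG := (contDiffWithinAt_gramForm g hy).differentiableWithinAt (by simp)
  have h1 := ((hG.hasFDerivWithinAt.clm_apply (hasFDerivWithinAt_const v _ _)).clm_apply
    (hasFDerivWithinAt_const w _ _))
  have h2 := h1.fderivWithin (uniqueDiffWithinAt_model (extChartAt_target_subset_range q hy))
  have h3 := DFunLike.congr_fun h2 u
  simp at h3
  exact h3

theorem christoffel_eq (g : Metric n M) (q : M) (u v w : Vec n) :
    christoffel g q u v w = christoffelWithin (range (𝓡∂ (n + 1))) (gramForm g q)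
      (extChartAt (𝓡∂ (n + 1)) q q) u v w := by
  simp only [christoffel, christoffelWithin, chartMetricDeriv_eq]

theorem hessian_eq_chartHessian_self (g : Metric n M) {f : M → ℝ} {q : M}
    (hf : ContMDiffAt (𝓡∂ (n + 1)) 𝓘(ℝ, ℝ) ∞ f q) (X Y : Vec n) :
    hessian g f q X Y = chartHessian g q f (extChartAt (𝓡∂ (n + 1)) q q) X Y
      (gradient g f q) := by
  have hy := extChartAt_target_subset_range q (mem_extChartAt_target (I := 𝓡∂ (n + 1)) q)
  have h1 := contDiffWithinAt_comp_symm (mem_extChartAt_source (I := 𝓡∂ (n + 1)) q) hf le_rfl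
  have h2 : DifferentiableWithinAt ℝ (fderivWithin ℝ (f ∘ (extChartAt (𝓡∂ (n + 1)) q).symm)
      (range (𝓡∂ (n + 1)))) (range (𝓡∂ (n + 1))) (extChartAt (𝓡∂ (n + 1)) q q) :=
    (h1.fderivWithin_right (m := 1) (𝓡∂ (n + 1)).uniqueDiffOn (by norm_cast)
      hy).differentiableWithinAt (by simp)
  have h3 := (h2.hasFDerivWithinAt.clm_apply (hasFDerivWithinAt_const Y _ _)).fderivWithin
    (uniqueDiffWithinAt_model hy)
  have h4 := DFunLike.congr_fun h3 X
  simp only [ContinuousLinearMap.comp_zero, zero_add, ContinuousLinearMap.flip_apply] at h4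
  exact congrArg₂ (· - ·) h4 (christoffel_eq g q X Y (gradient g f q))

/-- The Hessian can be computed in any chart. -/
theorem hessian_eq_chartHessian (g : Metric n M) {f : M → ℝ} {x q : M}
    (hq : q ∈ (extChartAt (𝓡∂ (n + 1)) x).source)
    (hf : ContMDiffAt (𝓡∂ (n + 1)) 𝓘(ℝ, ℝ) ∞ f q) {u v w U V : Vec n}
    (hu : (frame x (extChartAt (𝓡∂ (n + 1)) x q) u : Vec n) = U)
    (hv : (frame x (extChartAt (𝓡∂ (n + 1)) x q) v : Vec n) = V)
    (hw : (frame x (extChartAt (𝓡∂ (n + 1)) x q) w : Vec n) = gradient g f q) :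
    hessian g f q U V = chartHessian g x f (extChartAt (𝓡∂ (n + 1)) x q) u v w := by
  have ho := extChartAt_mem_overlap hq (mem_extChartAt_source q)
  have hτq := transition_extChartAt (x' := q) hq
  have hgrad := inner_sharp g q (mfderiv (𝓡∂ (n + 1)) 𝓘(ℝ, ℝ) f q).toLinearMap
  change ∀ z : Vec n, g.inner q (gradient g f q) z = mfderiv (𝓡∂ (n + 1)) 𝓘(ℝ, ℝ) f q z at hgrad
  have hmf := hf.mdifferentiableAt (by simp)
  have hm (z : Vec n) := mfderiv_frame (mem_extChartAt_source (I := 𝓡∂ (n + 1)) q) hmf z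
  have hm' (z : Vec n) : mfderiv (𝓡∂ (n + 1)) 𝓘(ℝ, ℝ) f q z =
      fderivWithin ℝ (f ∘ (extChartAt (𝓡∂ (n + 1)) q).symm) (range (𝓡∂ (n + 1)))
        (extChartAt (𝓡∂ (n + 1)) q q) z :=
    (congrArg _ (frame_self q z).symm).trans (hm z)
  have hin (a b : Vec n) : g.inner q a b = gramForm g q (extChartAt (𝓡∂ (n + 1)) q q) a b := by
    rw [← inner_frame g (mem_extChartAt_source q)]
    exact inner_congr g rfl (frame_self q a).symm (frame_self q b).symm
  rw [hessian_eq_chartHessian_self g hf]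
  -- From here only the defining identity `hgrad` of the gradient matters; with a free vector in its
  -- place, `subst` can eliminate it.
  generalize (gradient g f q : Vec n) = grad at *
  rw [frame_eq_fderivWithin_transition hq] at hu hv hw
  subst hu hv hw
  have hr := overlap_subset_range x q ho
  have hτ := contDiffWithinAt_transition ho
  have hτ2 : DifferentiableWithinAt ℝ (fderivWithin ℝ (transition x q) (range (𝓡∂ (n + 1))))
      (range (𝓡∂ (n + 1))) (extChartAt (𝓡∂ (n + 1)) x q) :=
    (hτ.fderivWithin_right (m := 1) (𝓡∂ (n + 1)).uniqueDiffOn (by norm_cast)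
      hr).differentiableWithinAt (by simp)
  have hsymm : IsSymmSndFDerivWithinAt ℝ (transition x q) (range (𝓡∂ (n + 1)))
      (extChartAt (𝓡∂ (n + 1)) x q) :=
    hτ.isSymmSndFDerivWithinAt (by simp only [minSmoothness_of_isRCLikeNormedField]; norm_cast)
      (𝓡∂ (n + 1)).uniqueDiffOn ((𝓡∂ (n + 1)).range_subset_closure_interior hr) hr
  have hyt := (extChartAt (𝓡∂ (n + 1)) x).map_source hq
  have hG' : DifferentiableWithinAt ℝ (gramForm g q) (range (𝓡∂ (n + 1)))
      (transition x q (extChartAt (𝓡∂ (n + 1)) x q)) :=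
    (contDiffWithinAt_gramForm g (transition_mem_target ho)).differentiableWithinAt (by simp)
  have hchr := christoffelWithin_pullback (uniqueDiffWithinAt_model hr) hr
    (differentiableWithinAt_transition ho) (tendsto_transition ho) hτ2 hsymm
    ((contDiffWithinAt_gramForm g hyt).differentiableWithinAt (by simp)) hG'
    (gramForm_symm g q _) (by
      filter_upwards [overlap_mem_nhdsWithin ho] with z hz v w
      exact chartMetric_transition g hz v w) u v w
  have hF := contDiffWithinAt_comp_symm (mem_extChartAt_source (I := 𝓡∂ (n + 1)) q) hf le_rfl
  rw [← hτq] at hF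
  have hr' : transition x q (extChartAt (𝓡∂ (n + 1)) x q) ∈ range (𝓡∂ (n + 1)) :=
    extChartAt_target_subset_range q (transition_mem_target ho)
  have hhess := fderivWithin_fderivWithin_comp (F := f ∘ (extChartAt (𝓡∂ (n + 1)) x).symm)
    (F' := f ∘ (extChartAt (𝓡∂ (n + 1)) q).symm) (τ := transition x q)
    (𝓡∂ (n + 1)).uniqueDiffOn hr
    (by filter_upwards [overlap_mem_nhdsWithin ho] with z hz
        using differentiableWithinAt_transition hz)
    (by filter_upwards [overlap_mem_nhdsWithin ho] with z hz using tendsto_transition hz) hτ2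
    (by
      have := (hF.of_le (m := 1) (by norm_cast)).eventually (by simp)
      rw [insert_eq_of_mem hr'] at this
      filter_upwards [this] with z hz using hz.differentiableWithinAt (by simp))
    ((hF.fderivWithin_right (m := 1) (𝓡∂ (n + 1)).uniqueDiffOn (by norm_cast)
      hr').differentiableWithinAt (by simp))
    (by
      filter_upwards [overlap_mem_nhdsWithin ho] with z hz
      exact congrArg f (symm_transition hz).symm) u v
  simp only [chartHessian]
  rw [hhess, hchr, ← hτq]
  -- The extra terms are `df(D²τ(u, v))` in the second derivative and `g(D²τ(u, v), ∇f)` in the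
  -- Christoffel symbol. They are equal, so they cancel.
  have := hgrad (fderivWithin ℝ (fderivWithin ℝ (transition x q) (range (𝓡∂ (n + 1))))
    (range (𝓡∂ (n + 1))) (extChartAt (𝓡∂ (n + 1)) x q) u v)
  rw [hm', hin, gramForm_symm, ← hτq] at this
  linarith

end Hessian

/-! ### The model convex function -/

section Bowl

variable {n : ℕ}

/-- A quadratic polynomial whose derivative at `p` is the first coordinate. -/
def bowl (p : Vec n) (k : ℝ) (y : Vec n) : ℝ := 2 + (y 0 - p 0) + k * ‖y - p‖ ^ 2

/-- The derivative of `bowl p k` at `y`. -/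
def bowlDeriv (p : Vec n) (k : ℝ) (y : Vec n) : Vec n →L[ℝ] ℝ :=
  EuclideanSpace.proj 0 + (2 * k) • innerSL ℝ (y - p)

theorem bowlDeriv_apply (p : Vec n) (k : ℝ) (y v : Vec n) :
    bowlDeriv p k y v = v 0 + 2 * k * inner ℝ (y - p) v := by
  simp [bowlDeriv, inner_sub_left]

theorem hasFDerivAt_bowl (p : Vec n) (k : ℝ) (y : Vec n) :
    HasFDerivAt (bowl p k) (bowlDeriv p k y) y := by
  have h1 : HasFDerivAt (fun y : Vec n => y 0) (EuclideanSpace.proj (𝕜 := ℝ) (0 : Fin (n + 1))) y :=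
    (EuclideanSpace.proj (𝕜 := ℝ) (0 : Fin (n + 1)) : Vec n →L[ℝ] ℝ).hasFDerivAt
  have h2 := (((hasFDerivAt_id y).sub_const p).norm_sq).const_mul k
  have h3 := ((h1.sub_const (p 0)).const_add 2).add h2
  refine h3.congr_fderiv ?_
  ext v
  simp [bowlDeriv]
  ring

theorem hasFDerivAt_bowlDeriv (p : Vec n) (k : ℝ) (y : Vec n) :
    HasFDerivAt (bowlDeriv p k) ((2 * k) • (innerSL ℝ : Vec n →L[ℝ] Vec n →L[ℝ] ℝ)) y := by
  have h := (((innerSL ℝ : Vec n →L[ℝ] Vec n →L[ℝ] ℝ).hasFDerivAt.comp y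
    ((hasFDerivAt_id y).sub_const p)).const_smul (2 * k)).const_add
      (EuclideanSpace.proj 0 : Vec n →L[ℝ] ℝ)
  exact h

theorem contDiff_bowl (p : Vec n) (k : ℝ) : ContDiff ℝ ∞ (bowl p k) := by
  have h1 : ContDiff ℝ ∞ (fun y : Vec n => y 0) :=
    (EuclideanSpace.proj (𝕜 := ℝ) (0 : Fin (n + 1)) : Vec n →L[ℝ] ℝ).contDiff
  have h2 : ContDiff ℝ ∞ (fun y : Vec n => ‖y - p‖ ^ 2) := (contDiff_id.sub contDiff_const).norm_sq ℝ
  exact (contDiff_const.add (h1.sub contDiff_const)).add (contDiff_const.mul h2)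

end Bowl

theorem comp_extChartAt_comp_symm {n : ℕ} {M : Type*} [TopologicalSpace M]
    [ChartedSpace (EuclideanHalfSpace (n + 1)) M] {F : Vec n → ℝ} {x : M} {y : Vec n}
    (hy : y ∈ (extChartAt (𝓡∂ (n + 1)) x).target) :
    (F ∘ extChartAt (𝓡∂ (n + 1)) x) ∘ (extChartAt (𝓡∂ (n + 1)) x).symm
      =ᶠ[𝓝[range (𝓡∂ (n + 1))] y] F := by
  filter_upwards [extChartAt_target_mem_nhdsWithin_of_mem hy] with z hz
  simp only [Function.comp_apply, (extChartAt (𝓡∂ (n + 1)) x).right_inv hz]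

/-! ### Local bounds on the metric and local convex functions -/

section Bounds

variable {n : ℕ} {M : Type*} [TopologicalSpace M] [ChartedSpace (EuclideanHalfSpace (n + 1)) M]
  [IsManifold (𝓡∂ (n + 1)) ∞ M]

theorem gramForm_pos (g : Metric n M) {x : M} {y : Vec n}
    (hy : y ∈ (extChartAt (𝓡∂ (n + 1)) x).target) {v : Vec n} (hv : v ≠ 0) :
    0 < gramForm g x y v v := by
  refine g.pos _ _ fun h => hv ?_
  have : IsManifold (𝓡∂ (n + 1)) 1 M := IsManifold.of_le (n := ∞) (by simp)
  have hi := (isInvertible_mfderivWithin_extChartAt_symm (I := 𝓡∂ (n + 1)) hy).injective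
  exact hi (h.trans (map_zero _).symm)

theorem exists_coercive {E : Type*} [NormedAddCommGroup E] [NormedSpace ℝ E]
    [FiniteDimensional ℝ E] (B : E →L[ℝ] E →L[ℝ] ℝ) (hB : ∀ v, v ≠ 0 → 0 < B v v) :
    ∃ c > 0, ∀ v, c * ‖v‖ ^ 2 ≤ B v v := by
  -- An empty unit sphere means that `E` is trivial; otherwise the constant is the minimum of `B v
  -- v` on the sphere.
  rcases (Metric.sphere (0 : E) 1).eq_empty_or_nonempty with h | h
  · refine ⟨1, one_pos, fun v => ?_⟩
    by_cases hv : v = 0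
    · simp [hv]
    · have : ‖v‖⁻¹ • v ∈ Metric.sphere (0 : E) 1 := by
        simp [norm_smul, inv_mul_cancel₀ (norm_ne_zero_iff.2 hv)]
      simp [h] at this
  · have hcont : Continuous fun v => B v v := B.continuous.clm_apply continuous_id
    obtain ⟨v₀, hv₀, hmin⟩ := (isCompact_sphere (0 : E) 1).exists_isMinOn h hcont.continuousOn
    refine ⟨B v₀ v₀, hB v₀ (ne_zero_of_mem_unit_sphere ⟨v₀, hv₀⟩), fun v => ?_⟩
    by_cases hv : v = 0
    · simp [hv]
    · have hn : ‖v‖ ≠ 0 := norm_ne_zero_iff.2 hv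
      have hm : ‖v‖⁻¹ • v ∈ Metric.sphere (0 : E) 1 := by
        simp [norm_smul, inv_mul_cancel₀ hn]
      have h1 : B v₀ v₀ ≤ B (‖v‖⁻¹ • v) (‖v‖⁻¹ • v) := hmin hm
      have h2 : B (‖v‖⁻¹ • v) (‖v‖⁻¹ • v) * ‖v‖ ^ 2 = B v v := by
        simp only [map_smul, smul_apply, smul_eq_mul]
        field_simp
      rw [← h2]
      gcongr

set_option maxSynthPendingDepth 3 in
-- Boundedness of `G` and its derivative and coercivity of `G` hold at `p` and persist nearby by
-- continuity, at the price of enlarging the upper constants by `1` and halving the coercivity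
-- constant.
theorem exists_bilinear_bounds {E : Type*} [NormedAddCommGroup E] [NormedSpace ℝ E]
    [FiniteDimensional ℝ E] {s : Set E} {G : E → E →L[ℝ] E →L[ℝ] ℝ} {p : E}
    (hG : ContDiffWithinAt ℝ ∞ G s p) (hs : UniqueDiffOn ℝ s) (hp : p ∈ s)
    (hpos : ∀ v, v ≠ 0 → 0 < G p v v) :
    ∃ C > 0, ∃ c > 0, ∀ᶠ y in 𝓝[s] p,
      (∀ v w, |G y v w| ≤ C * ‖v‖ * ‖w‖) ∧
      (∀ u v w, |fderivWithin ℝ G s y u v w| ≤ C * ‖u‖ * ‖v‖ * ‖w‖) ∧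
      ∀ v, c * ‖v‖ ^ 2 ≤ G y v v := by
  have hG1 : ContinuousWithinAt (fderivWithin ℝ G s) s p :=
    (hG.fderivWithin_right (m := 1) hs (by norm_cast) hp).continuousWithinAt
  obtain ⟨c, hc, hcoer⟩ := exists_coercive (G p) hpos
  have e1 : ∀ᶠ y in 𝓝[s] p, ‖G y - G p‖ < min (c / 2) 1 := by
    have := (hG.continuousWithinAt.tendsto.sub_const (G p)).norm
    rw [sub_self, norm_zero] at this
    exact this.eventually (gt_mem_nhds (by positivity))
  have e2 : ∀ᶠ y in 𝓝[s] p, ‖fderivWithin ℝ G s y‖ < ‖fderivWithin ℝ G s p‖ + 1 :=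
    hG1.tendsto.norm.eventually (gt_mem_nhds (lt_add_one _))
  refine ⟨max (‖G p‖ + 1) (‖fderivWithin ℝ G s p‖ + 1), by positivity, c / 2, half_pos hc, ?_⟩
  filter_upwards [e1, e2] with y h1 h2
  refine ⟨fun v w => ?_, fun u v w => ?_, fun v => ?_⟩
  · have h4 : ‖G y‖ ≤ ‖G p‖ + 1 := by
      have := norm_le_norm_add_norm_sub' (G y) (G p)
      linarith [min_le_right (c / 2) 1]
    rw [← Real.norm_eq_abs]
    refine ((G y).le_opNorm₂ v w).trans ?_
    gcongr
    exact h4.trans (le_max_left _ _)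
  · rw [← Real.norm_eq_abs]
    refine ((fderivWithin ℝ G s y u).le_opNorm₂ v w).trans ?_
    gcongr
    refine (ContinuousLinearMap.le_opNorm _ _).trans ?_
    gcongr
    exact h2.le.trans (le_max_right _ _)
  · have h4 := (G y - G p).le_opNorm₂ v v
    rw [Real.norm_eq_abs] at h4
    have h5 := (abs_le.1 h4).1
    simp only [sub_apply] at h5
    have h6 : ‖G y - G p‖ * ‖v‖ * ‖v‖ ≤ c / 2 * ‖v‖ * ‖v‖ := by
      gcongr
      exact h1.le.trans (min_le_left _ _)
    nlinarith [hcoer v]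

theorem exists_gramForm_bounds (g : Metric n M) {x : M} {p : Vec n}
    (hp : p ∈ (extChartAt (𝓡∂ (n + 1)) x).target) :
    ∃ R > 0, ∃ C > 0, ∃ c > 0, ∀ y ∈ range (𝓡∂ (n + 1)), dist y p ≤ R →
      y ∈ (extChartAt (𝓡∂ (n + 1)) x).target ∧
      (∀ v w, |gramForm g x y v w| ≤ C * ‖v‖ * ‖w‖) ∧
      (∀ u v w, |fderivWithin ℝ (gramForm g x) (range (𝓡∂ (n + 1))) y u v w| ≤
        C * ‖u‖ * ‖v‖ * ‖w‖) ∧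
      ∀ v, c * ‖v‖ ^ 2 ≤ gramForm g x y v v := by
  obtain ⟨C, hC, c, hc, h⟩ := exists_bilinear_bounds (contDiffWithinAt_gramForm g hp)
    (𝓡∂ (n + 1)).uniqueDiffOn (extChartAt_target_subset_range x hp)
    fun v hv => gramForm_pos g hp hv
  have e3 := extChartAt_target_mem_nhdsWithin_of_mem (I := 𝓡∂ (n + 1)) hp
  obtain ⟨R, hR, hball⟩ := Metric.mem_nhdsWithin_iff.1 (h.and e3)
  refine ⟨R / 2, half_pos hR, C, hC, c, hc, fun y hy hd => ?_⟩
  obtain ⟨h1, h2⟩ := hball ⟨Metric.mem_ball.2 (by linarith), hy⟩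
  exact ⟨h2, h1⟩

/-- The properties required of the convex function at the point `q`, with `c` as the lower bound
for its gradient. -/
structure IsConvexAt (g : Metric n M) (f : M → ℝ) (c : ℝ) (q : M) : Prop where
  contMDiffAt : ContMDiffAt (𝓡∂ (n + 1)) 𝓘(ℝ, ℝ) ∞ f q
  sq_le_hessian : ∀ X : TangentSpace (𝓡∂ (n + 1)) q, tangentNorm g X ^ 2 ≤ hessian g f q X X
  le_gradient : c ≤ tangentNorm g (gradient g f q)
  one_le : 1 ≤ f q
  inner_lt : q ∈ (𝓡∂ (n + 1)).boundary M → g.inner q (gradient g f q) (outwardNormal g q) < 0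

theorem tangentNorm_sq (g : Metric n M) {q : M} (X : TangentSpace (𝓡∂ (n + 1)) q) :
    tangentNorm g X ^ 2 = g.inner q X X := by
  refine Real.sq_sqrt ?_
  by_cases h : X = 0
  · simp [h]
  · exact (g.pos q X h).le

theorem tangentNorm_pos (g : Metric n M) {q : M} {X : TangentSpace (𝓡∂ (n + 1)) q} (h : X ≠ 0) :
    0 < tangentNorm g X :=
  Real.sqrt_pos.2 (g.pos q X h)

theorem contMDiffOn_comp_extChartAt {F : Vec n → ℝ} (hF : ContDiff ℝ ∞ F) (x : M) :
    ContMDiffOn (𝓡∂ (n + 1)) 𝓘(ℝ, ℝ) ∞ (F ∘ extChartAt (𝓡∂ (n + 1)) x)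
      (extChartAt (𝓡∂ (n + 1)) x).source := by
  rw [extChartAt_source]
  exact hF.contMDiff.comp_contMDiffOn contMDiffOn_extChartAt

theorem mfderiv_comp_extChartAt_frame {F : Vec n → ℝ} (hF : ContDiff ℝ ∞ F) {x q : M}
    (hq : q ∈ (extChartAt (𝓡∂ (n + 1)) x).source) (v : Vec n) :
    mfderiv (𝓡∂ (n + 1)) 𝓘(ℝ, ℝ) (F ∘ extChartAt (𝓡∂ (n + 1)) x) q
      (frame x (extChartAt (𝓡∂ (n + 1)) x q) v : Vec n) =
      fderiv ℝ F (extChartAt (𝓡∂ (n + 1)) x q) v := by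
  have hy := (extChartAt (𝓡∂ (n + 1)) x).map_source hq
  have hr := extChartAt_target_subset_range x hy
  have hsm := (contMDiffOn_comp_extChartAt hF x).contMDiffAt
    ((isOpen_extChartAt_source x).mem_nhds hq)
  rw [mfderiv_frame hq (hsm.mdifferentiableAt (by simp)),
    (comp_extChartAt_comp_symm hy).fderivWithin_eq
      ((comp_extChartAt_comp_symm (F := F) hy).self_of_nhdsWithin hr),
    ((hF.differentiable (by simp)) _).fderivWithin (uniqueDiffWithinAt_model hr)]

theorem exists_frame_gradient (g : Metric n M) {F : Vec n → ℝ} (hF : ContDiff ℝ ∞ F) {x q : M}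
    (hq : q ∈ (extChartAt (𝓡∂ (n + 1)) x).source) :
    ∃ w : Vec n, (frame x (extChartAt (𝓡∂ (n + 1)) x q) w : Vec n) =
        gradient g (F ∘ extChartAt (𝓡∂ (n + 1)) x) q ∧
      ∀ v, gramForm g x (extChartAt (𝓡∂ (n + 1)) x q) w v =
        fderiv ℝ F (extChartAt (𝓡∂ (n + 1)) x q) v := by
  obtain ⟨w, hw⟩ := exists_frame_eq hq (gradient g (F ∘ extChartAt (𝓡∂ (n + 1)) x) q)
  refine ⟨w, hw, fun v => ?_⟩
  rw [← mfderiv_comp_extChartAt_frame hF hq, ← inner_frame g hq]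
  have h := inner_sharp g q
    (mfderiv (𝓡∂ (n + 1)) 𝓘(ℝ, ℝ) (F ∘ extChartAt (𝓡∂ (n + 1)) x) q).toLinearMap
    (frame x (extChartAt (𝓡∂ (n + 1)) x q) v : Vec n)
  exact (inner_congr g rfl hw rfl).trans h

/-- At a boundary point `normalCovector` is a positive multiple `a` of `dy 0` for every chart. Hence
its dual vector is `a` times the coordinate gradient `m` of `y 0`. -/
theorem exists_frame_normal (g : Metric n M) {x q : M}
    (hq : q ∈ (extChartAt (𝓡∂ (n + 1)) x).source) (hb : q ∈ (𝓡∂ (n + 1)).boundary M) :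
    ∃ a > (0 : ℝ), ∃ m : Vec n, (frame x (extChartAt (𝓡∂ (n + 1)) x q) (a • m) : Vec n) =
        sharp g q (normalCovector q) ∧
      ∀ v, gramForm g x (extChartAt (𝓡∂ (n + 1)) x q) m v = v 0 := by
  obtain ⟨a, ha, h⟩ := exists_normalCovector_frame hq hb
  obtain ⟨m, hm⟩ := exists_frame_eq hq (sharp g q (normalCovector q))
  refine ⟨a, ha, a⁻¹ • m, by rw [smul_smul, mul_inv_cancel₀ ha.ne', one_smul, hm], fun v => ?_⟩
  have h2 := inner_sharp g q (normalCovector q) (frame x (extChartAt (𝓡∂ (n + 1)) x q) v : Vec n)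
  have h3 := (inner_congr g rfl hm rfl).trans h2
  have h4 := (inner_frame g hq m v).symm.trans (h3.trans (h v))
  rw [map_smul, smul_apply, h4, smul_eq_mul, inv_mul_cancel_left₀ ha.ne']

theorem chartHessian_bowl (g : Metric n M) {x : M} {y : Vec n}
    (hy : y ∈ (extChartAt (𝓡∂ (n + 1)) x).target) (p : Vec n) (k : ℝ) (u v w : Vec n) :
    chartHessian g x (bowl p k ∘ extChartAt (𝓡∂ (n + 1)) x) y u v w =
      2 * k * inner ℝ u v -
        christoffelWithin (range (𝓡∂ (n + 1))) (gramForm g x) y u v w := by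
  have hr := extChartAt_target_subset_range x hy
  have h1 : fderivWithin ℝ ((bowl p k ∘ extChartAt (𝓡∂ (n + 1)) x) ∘
      (extChartAt (𝓡∂ (n + 1)) x).symm) (range (𝓡∂ (n + 1))) =ᶠ[𝓝[range (𝓡∂ (n + 1))] y]
      bowlDeriv p k := by
    filter_upwards [extChartAt_target_mem_nhdsWithin_of_mem hy] with z hz
    have hzr := extChartAt_target_subset_range x hz
    rw [(comp_extChartAt_comp_symm hz).fderivWithin_eq
      ((comp_extChartAt_comp_symm (F := bowl p k) hz).self_of_nhdsWithin hzr)]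
    exact (hasFDerivAt_bowl p k z).hasFDerivWithinAt.fderivWithin (uniqueDiffWithinAt_model hzr)
  rw [chartHessian, h1.fderivWithin_eq (h1.self_of_nhdsWithin hr),
    (hasFDerivAt_bowlDeriv p k y).hasFDerivWithinAt.fderivWithin (uniqueDiffWithinAt_model hr)]
  rfl

theorem abs_christoffelWithin_le {E : Type*} [NormedAddCommGroup E] [NormedSpace ℝ E] {s : Set E}
    {G : E → E →L[ℝ] E →L[ℝ] ℝ} {y : E} {C : ℝ}
    (h : ∀ u v w, |fderivWithin ℝ G s y u v w| ≤ C * ‖u‖ * ‖v‖ * ‖w‖) (u w : E) :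
    |christoffelWithin s G y u u w| ≤ 3 / 2 * C * ‖u‖ ^ 2 * ‖w‖ := by
  have h1 := abs_le.1 (h u u w)
  have h2 := abs_le.1 (h w u u)
  rw [christoffelWithin, abs_le]
  constructor <;> nlinarith

/-- Around every point of a chart there is a strictly convex function with nonzero gradient that
increases from the boundary inwards. -/
theorem exists_isConvexAt (g : Metric n M) {x : M} {p : Vec n}
    (hp : p ∈ (extChartAt (𝓡∂ (n + 1)) x).target) :
    ∃ R > 0, ∃ c > 0, ∃ F : Vec n → ℝ, ContDiff ℝ ∞ F ∧
      (∀ y ∈ range (𝓡∂ (n + 1)), dist y p ≤ R → y ∈ (extChartAt (𝓡∂ (n + 1)) x).target) ∧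
      ∀ q ∈ (extChartAt (𝓡∂ (n + 1)) x).source, dist (extChartAt (𝓡∂ (n + 1)) x q) p ≤ R →
        IsConvexAt g (F ∘ extChartAt (𝓡∂ (n + 1)) x) c q := by
  obtain ⟨R₁, hR₁, C, hC, c, hc, hb⟩ := exists_gramForm_bounds g hp
  -- The metric costs `C ‖v‖²`. The Christoffel term costs `3 / 2 * C * ‖v‖² * ‖w‖`, at most `3 * C
  -- / c * ‖v‖²` since the gradient `w` satisfies `‖w‖ ≤ 2 / c`. The Hessian supplies `2 * k *
  -- ‖v‖²`.
  set k : ℝ := C + 3 * C / c with hk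
  have hkpos : 0 < k := by positivity
  -- In order: `R₁` keeps the metric bounds valid, `1` gives `F ≥ 1`, `1 / (4 * k)` makes the
  -- quadratic part of `dF` at most half of `‖v‖`, and `c / (4 * C * k)` keeps `dF` positive on the
  -- inward normal.
  set R : ℝ := min (min R₁ 1) (min (1 / (4 * k)) (c / (4 * C * k))) with hR
  have hRpos : 0 < R := by positivity
  have hRR₁ : R ≤ R₁ := (min_le_left _ _).trans (min_le_left _ _)
  have hR1 : R ≤ 1 := (min_le_left _ _).trans (min_le_right _ _)
  have hRk : k * R ≤ 1 / 4 := by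
    have : R ≤ 1 / (4 * k) := (min_le_right _ _).trans (min_le_left _ _)
    rw [le_div_iff₀ (by positivity)] at this
    linarith
  have hRc : C * (k * R) ≤ c / 4 := by
    have : R ≤ c / (4 * C * k) := (min_le_right _ _).trans (min_le_right _ _)
    rw [le_div_iff₀ (by positivity)] at this
    linarith
  refine ⟨R, hRpos, √(c / (4 * C ^ 2)), by positivity, bowl p k, contDiff_bowl p k,
    fun y hy hd => (hb y hy (hd.trans hRR₁)).1, fun q hq hd => ?_⟩
  have hyt := (extChartAt (𝓡∂ (n + 1)) x).map_source hq
  obtain ⟨-, hG, hdG, hcoer⟩ := hb _ (extChartAt_target_subset_range x hyt) (hd.trans hRR₁)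
  have hsm := (contMDiffOn_comp_extChartAt (contDiff_bowl p k) x).contMDiffAt
    ((isOpen_extChartAt_source x).mem_nhds hq)
  obtain ⟨w, hw, hwdF⟩ := exists_frame_gradient g (contDiff_bowl p k) hq
  have hin := inner_frame g hq
  set y := extChartAt (𝓡∂ (n + 1)) x q with hy
  simp only [(hasFDerivAt_bowl p k y).fderiv, bowlDeriv_apply] at hwdF
  rw [dist_eq_norm] at hd
  have habs (v : Vec n) : |inner ℝ (y - p) v| ≤ R * ‖v‖ :=
    (abs_real_inner_le_norm _ _).trans (by gcongr)
  have hcoord (v : Vec n) : |v 0| ≤ ‖v‖ := EuclideanSpace.norm_eq v ▸ by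
    refine Real.abs_le_sqrt ?_
    have := Finset.single_le_sum (f := fun i => ‖v i‖ ^ 2) (fun i _ => sq_nonneg _)
      (Finset.mem_univ (0 : Fin (n + 1)))
    simpa using this
  have hy0 := abs_le.1 ((hcoord (y - p)).trans hd)
  simp only [PiLp.sub_apply] at hy0
  have hnw : c * ‖w‖ ≤ 2 := by
    have h1 := hcoer w
    rw [hwdF] at h1
    have h2 := (abs_le.1 (habs w)).2
    have h3 := (abs_le.1 (hcoord w)).2
    have h4 : 2 * k * inner ℝ (y - p) w ≤ 2 * k * (R * ‖w‖) := by gcongr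
    by_contra! hcon
    nlinarith [norm_nonneg w]
  have he0 : ‖(EuclideanSpace.single 0 1 : Vec n)‖ = 1 := by simp
  -- Test the gradient against `e 0`, where `dF` is at least `1 / 2`. With coercivity this gives the
  -- bound `√(c / (4 * C ^ 2))` for the gradient.
  have hlow : 1 ≤ 2 * C * ‖w‖ := by
    have h1 := hwdF (EuclideanSpace.single 0 1)
    have h2 := (abs_le.1 (hG w (EuclideanSpace.single 0 1))).2
    have h3 := (abs_le.1 (habs (EuclideanSpace.single 0 1))).1
    rw [he0] at h2 h3
    have h4 : 2 * k * -(R * 1) ≤ 2 * k * inner ℝ (y - p) (EuclideanSpace.single 0 1) := by gcongr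
    have h5 : (EuclideanSpace.single 0 1 : Vec n) 0 = 1 := by simp
    rw [h5] at h1
    linarith
  refine ⟨hsm, fun X => ?_, ?_, ?_, fun hbd => ?_⟩
  · obtain ⟨v, hv⟩ := exists_frame_eq hq X
    have h1 : hessian g (bowl p k ∘ extChartAt (𝓡∂ (n + 1)) x) q X X = _ :=
      hessian_eq_chartHessian g hq hsm hv hv hw
    rw [h1, chartHessian_bowl g hyt, tangentNorm_sq]
    have h2 : g.inner q X X = gramForm g x y v v :=
      (inner_congr g rfl hv hv).symm.trans (hin v v)
    rw [h2, real_inner_self_eq_norm_sq]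
    have h3 := (abs_le.1 (hG v v)).2
    have h4 := (abs_le.1 (abs_christoffelWithin_le hdG v w)).2
    have h5 : 3 / 2 * C * ‖v‖ ^ 2 * ‖w‖ ≤ 3 / 2 * C * ‖v‖ ^ 2 * (2 / c) := by
      gcongr
      rw [le_div_iff₀ hc]
      linarith
    have h6 : 2 * k * ‖v‖ ^ 2 = C * ‖v‖ * ‖v‖ + 3 / 2 * C * ‖v‖ ^ 2 * (2 / c) +
        (C + 3 * C / c) * ‖v‖ ^ 2 := by
      rw [hk]; ring
    have h7 : 0 ≤ (C + 3 * C / c) * ‖v‖ ^ 2 := by positivity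
    linarith
  · refine Real.sqrt_le_sqrt ?_
    have h1 : g.inner q (gradient g (bowl p k ∘ extChartAt (𝓡∂ (n + 1)) x) q)
        (gradient g (bowl p k ∘ extChartAt (𝓡∂ (n + 1)) x) q) = gramForm g x y w w :=
      (inner_congr g rfl hw hw).symm.trans (hin w w)
    rw [h1]
    refine le_trans ?_ (hcoer w)
    rw [div_le_iff₀ (by positivity)]
    have : 1 ≤ (2 * C * ‖w‖) ^ 2 := one_le_pow₀ hlow
    nlinarith
  · have h1 : 0 ≤ k * ‖y - p‖ ^ 2 := by positivity
    change 1 ≤ 2 + (y 0 - p 0) + k * ‖y - p‖ ^ 2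
    linarith
  · obtain ⟨a, ha, m, hm, hmv⟩ := exists_frame_normal g hq hbd
    have hmpos : 1 ≤ C * ‖m‖ := by
      have h1 := hmv (EuclideanSpace.single 0 1)
      have h2 := (abs_le.1 (hG m (EuclideanSpace.single 0 1))).2
      rw [he0, h1] at h2
      simpa using h2
    have hm0 : 0 < ‖m‖ := by
      by_contra! hcon
      nlinarith
    have h1 : g.inner q (gradient g (bowl p k ∘ extChartAt (𝓡∂ (n + 1)) x) q)
        (sharp g q (normalCovector q)) = a * (m 0 + 2 * k * inner ℝ (y - p) m) := by
      refine ((inner_congr g rfl hw hm).symm.trans (hin w (a • m))).trans ?_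
      rw [map_smul, hwdF, smul_eq_mul]
    -- Here `m 0 = g(m, m) ≥ c ‖m‖²`, and `C ‖m‖ ≥ 1` turns this into a bound linear in `‖m‖`, which
    -- beats the error `2 * k * R * ‖m‖`.
    have h2 : 0 < m 0 + 2 * k * inner ℝ (y - p) m := by
      have h3 := hcoer m
      rw [hmv m] at h3
      have h4 := (abs_le.1 (habs m)).1
      have h5 : 2 * k * -(R * ‖m‖) ≤ 2 * k * inner ℝ (y - p) m := by gcongr
      have h6 : c * ‖m‖ ≤ C * (c * ‖m‖ ^ 2) := by nlinarith [mul_pos hc hm0]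
      have h7 : C * (2 * k * (R * ‖m‖)) ≤ c / 2 * ‖m‖ := by nlinarith
      have h8 : 0 < C * (c * ‖m‖ ^ 2 - 2 * k * (R * ‖m‖)) := by nlinarith [mul_pos hc hm0]
      have h9 := pos_of_mul_pos_right h8 hC.le
      linarith
    have hN : (sharp g q (normalCovector q) : Vec n) ≠ 0 := by
      intro h0
      have h3 : g.inner q (gradient g (bowl p k ∘ extChartAt (𝓡∂ (n + 1)) x) q)
        (sharp g q (normalCovector q)) = 0 := by
          exact (congrArg _ h0).trans (map_zero _)
      rw [h1] at h3
      exact (mul_pos ha h2).ne' h3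
    have ht := tangentNorm_pos g hN
    have h3 : g.inner q (gradient g (bowl p k ∘ extChartAt (𝓡∂ (n + 1)) x) q)
        (outwardNormal g q) = -((tangentNorm g (sharp g q (normalCovector q)))⁻¹ *
          (a * (m 0 + 2 * k * inner ℝ (y - p) m))) := by
      rw [outwardNormal, map_neg, map_smul, smul_eq_mul, h1]
    rw [h3]
    have := mul_pos (inv_pos.2 ht) (mul_pos ha h2)
    linarith

end Bounds

open scoped ENNReal

/-! ### Measures carried by charts -/

section Measures

theorem measurableSet_inter_preimage_of_continuousOn {E X : Type*} [TopologicalSpace E]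
    [MeasurableSpace E] [BorelSpace E] [TopologicalSpace X] [MeasurableSpace X] [BorelSpace X]
    {T : Set E} (hT : MeasurableSet T) {ψ : E → X} (hψ : ContinuousOn ψ T) {A : Set X}
    (hA : MeasurableSet A) : MeasurableSet (T ∩ ψ ⁻¹' A) := by
  have h := hT.subtype_image ((continuousOn_iff_continuous_domRestrict.1 hψ).measurable hA)
  rwa [show ((↑) : T → E) '' (T.domRestrict ψ ⁻¹' A) = T ∩ ψ ⁻¹' A by
    ext y; simp [and_comm]] at h

variable {E X : Type*} [NormedAddCommGroup E] [MeasurableSpace E] [BorelSpace E]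
  [TopologicalSpace X] [MeasurableSpace X] [BorelSpace X]

/-- `ψ` is controlled only on `T`. This makes it a.e. measurable for the restricted measure, without
which `Measure.map` would be zero by convention. -/
theorem map_withDensity_apply_of_continuousOn (μ : Measure E) [SFinite μ] {T : Set E}
    (hT : MeasurableSet T) {ψ : E → X} (hψ : ContinuousOn ψ T) (ρ : E → ℝ≥0∞) {A : Set X}
    (hA : MeasurableSet A) :
    (((μ.restrict T).withDensity ρ).map ψ) A = ∫⁻ y in T ∩ ψ ⁻¹' A, ρ y ∂μ := by
  have hm : AEMeasurable ψ ((μ.restrict T).withDensity ρ) :=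
    (hψ.aemeasurable hT).mono_ac (withDensity_absolutelyContinuous _ _)
  rw [Measure.map_apply_of_aemeasurable hm hA, withDensity_apply',
    Measure.restrict_restrict' hT, inter_comm]

/-- Change of variables between two parametrizations of the same set. -/
theorem restrict_map_withDensity_le [NormedSpace ℝ E] [FiniteDimensional ℝ E]
    (μ : Measure E) [μ.IsAddHaarMeasure]
    {T₁ T₂ : Set E} (hT₁ : MeasurableSet T₁) (hT₂ : MeasurableSet T₂) {ψ₁ ψ₂ : E → X}
    (hψ₁ : ContinuousOn ψ₁ T₁) (hψ₂ : ContinuousOn ψ₂ T₂) {ρ₁ ρ₂ : E → ℝ≥0∞} {U : Set X}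
    (hU : MeasurableSet U) {σ : E → E} {σ' : E → E →L[ℝ] E}
    (hσ' : ∀ y ∈ T₁ ∩ ψ₁ ⁻¹' U, HasFDerivWithinAt σ (σ' y) (T₁ ∩ ψ₁ ⁻¹' U) y)
    (hinj : InjOn σ (T₁ ∩ ψ₁ ⁻¹' U)) (hmem : ∀ y ∈ T₁ ∩ ψ₁ ⁻¹' U, σ y ∈ T₂)
    (hψ : ∀ y ∈ T₁ ∩ ψ₁ ⁻¹' U, ψ₂ (σ y) = ψ₁ y)
    (hρ : ∀ y ∈ T₁ ∩ ψ₁ ⁻¹' U, ρ₁ y = ENNReal.ofReal |(σ' y).det| * ρ₂ (σ y)) :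
    (((μ.restrict T₁).withDensity ρ₁).map ψ₁).restrict U ≤
      ((μ.restrict T₂).withDensity ρ₂).map ψ₂ := by
  refine Measure.le_iff.2 fun A hA => ?_
  have hAU := hA.inter hU
  have hsub : T₁ ∩ ψ₁ ⁻¹' (A ∩ U) ⊆ T₁ ∩ ψ₁ ⁻¹' U := fun y hy => ⟨hy.1, hy.2.2⟩
  have hms := measurableSet_inter_preimage_of_continuousOn hT₁ hψ₁ hAU
  rw [Measure.restrict_apply hA, map_withDensity_apply_of_continuousOn μ hT₁ hψ₁ _ hAU,
    map_withDensity_apply_of_continuousOn μ hT₂ hψ₂ _ hA,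
    setLIntegral_congr_fun hms fun y hy => hρ y (hsub hy),
    ← lintegral_image_eq_lintegral_abs_det_fderiv_mul μ hms
      (fun y hy => (hσ' y (hsub hy)).mono hsub) (hinj.mono hsub)]
  refine lintegral_mono_set ?_
  rintro _ ⟨y, hy, rfl⟩
  exact ⟨hmem y (hsub hy), by rw [mem_preimage, hψ y (hsub hy)]; exact hy.2.1⟩

theorem map_withDensity_lt_top (μ : Measure E) [SFinite μ] {T : Set E}
    (hT : MeasurableSet T) {ψ : E → X} (hψ : ContinuousOn ψ T) {ρ : E → ℝ≥0∞} {U : Set X}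
    (hU : MeasurableSet U) {K : Set E} (hK : μ K < ⊤) (hTK : T ∩ ψ ⁻¹' U ⊆ K) {C : ℝ≥0∞}
    (hC : C < ⊤) (hρ : ∀ y ∈ T ∩ ψ ⁻¹' U, ρ y ≤ C) :
    (((μ.restrict T).withDensity ρ).map ψ) U < ⊤ := by
  rw [map_withDensity_apply_of_continuousOn μ hT hψ _ hU]
  calc ∫⁻ y in T ∩ ψ ⁻¹' U, ρ y ∂μ ≤ ∫⁻ _ in T ∩ ψ ⁻¹' U, C ∂μ :=
        setLIntegral_mono' (measurableSet_inter_preimage_of_continuousOn hT hψ hU) hρ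
    _ = C * μ (T ∩ ψ ⁻¹' U) := by simp
    _ ≤ C * μ K := by gcongr
    _ < ⊤ := ENNReal.mul_lt_top hC hK

/-- By compatibility every `m x` is at most `m i` on `U i`. A finite subcover therefore dominates
the whole supremum by the finite sum of the `m i` restricted to `U i`. -/
theorem isFiniteMeasure_iSup [CompactSpace X] (m : X → Measure X) (S : X → Set X)
    (h : ∀ x x', (m x).restrict (S x') ≤ m x')
    (hfin : ∀ x, ∃ U, IsOpen U ∧ x ∈ U ∧ U ⊆ S x ∧ m x U < ⊤) :
    IsFiniteMeasure (⨆ x, m x) := by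
  choose U hUo hUx hUS hUfin using hfin
  obtain ⟨t, ht⟩ := isCompact_univ.elim_finite_subcover U hUo
    fun x _ => mem_iUnion.2 ⟨x, hUx x⟩
  have hle : (⨆ x, m x) ≤ ∑ i ∈ t, (m i).restrict (U i) := by
    refine iSup_le fun x => Measure.le_iff.2 fun A hA => ?_
    calc m x A ≤ m x (⋃ i ∈ t, A ∩ U i) := measure_mono fun a ha => by
          have := ht (mem_univ a)
          simp only [mem_iUnion, exists_prop] at this ⊢
          exact this.imp fun i hi => ⟨hi.1, ha, hi.2⟩
      _ ≤ ∑ i ∈ t, m x (A ∩ U i) := measure_biUnion_finset_le _ _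
      _ ≤ ∑ i ∈ t, m i (A ∩ U i) := Finset.sum_le_sum fun i _ => by
          have hAU := hA.inter (hUo i).measurableSet
          have := Measure.le_iff.1 (h x i) _ hAU
          rwa [Measure.restrict_apply hAU,
            inter_eq_left.2 (inter_subset_right.trans (hUS i))] at this
      _ = (∑ i ∈ t, (m i).restrict (U i)) A := by
          rw [Measure.finsetSum_apply]
          exact Finset.sum_congr rfl fun i _ => (Measure.restrict_apply hA).symm
  refine ⟨(Measure.le_iff.1 hle _ MeasurableSet.univ).trans_lt ?_⟩
  rw [Measure.finsetSum_apply]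
  refine ENNReal.sum_lt_top.2 fun i _ => ?_
  rw [Measure.restrict_apply_univ]
  exact hUfin i

/-- The Gram matrix changes by congruence with the matrix of `A`. `J` is the identity for the volume
of `M` and the inclusion of the boundary hyperplane for that of `∂M`. -/
theorem det_gram_comp {m : ℕ} {W : Type*} [AddCommGroup W] [Module ℝ W] (B : W →ₗ[ℝ] W →ₗ[ℝ] ℝ)
    (J : EuclideanSpace ℝ (Fin m) →ₗ[ℝ] W)
    (A : EuclideanSpace ℝ (Fin m) →ₗ[ℝ] EuclideanSpace ℝ (Fin m)) :
    (Matrix.of fun i j : Fin m => B (J (A (EuclideanSpace.single i 1)))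
      (J (A (EuclideanSpace.single j 1)))).det =
    LinearMap.det A ^ 2 * (Matrix.of fun i j : Fin m => B (J (EuclideanSpace.single i 1))
      (J (EuclideanSpace.single j 1))).det := by
  let b := (EuclideanSpace.basisFun (Fin m) ℝ).toBasis
  let B' : LinearMap.BilinForm ℝ (EuclideanSpace ℝ (Fin m)) := B.compl₁₂ J J
  have h1 : (Matrix.of fun i j : Fin m => B (J (EuclideanSpace.single i 1))
      (J (EuclideanSpace.single j 1))) = LinearMap.BilinForm.toMatrix b B' := by
    ext i j
    simp [b, B', LinearMap.BilinForm.toMatrix_apply]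
  have h2 : (Matrix.of fun i j : Fin m => B (J (A (EuclideanSpace.single i 1)))
      (J (A (EuclideanSpace.single j 1)))) = LinearMap.BilinForm.toMatrix b (B'.comp A A) := by
    ext i j
    simp [b, B', LinearMap.BilinForm.toMatrix_apply]
  rw [h1, h2, LinearMap.BilinForm.toMatrix_comp b b, Matrix.det_mul, Matrix.det_mul,
    Matrix.det_transpose, LinearMap.det_toMatrix]
  ring

theorem sqrt_det_le {m : ℕ} {C : ℝ} (A : Matrix (Fin m) (Fin m) ℝ) (h : ∀ i j, |A i j| ≤ C) :
    √A.det ≤ √((m.factorial : ℝ) * C ^ m) := by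
  refine Real.sqrt_le_sqrt ((le_abs_self _).trans ?_)
  have := Matrix.det_le (A := A) (abv := AbsoluteValue.abs) (x := C) h
  simpa using this

end Measures

/-! ### Finiteness of the Riemannian measures of `M` and `∂M` -/

section Riemannian

variable {n : ℕ} {M : Type*} [TopologicalSpace M] [ChartedSpace (EuclideanHalfSpace (n + 1)) M]

/-- `boundaryIncl` as a continuous linear map. -/
def inclL (n : ℕ) : EuclideanSpace ℝ (Fin n) →L[ℝ] Vec n :=
  LinearMap.toContinuousLinearMap
    { toFun := boundaryIncl
      map_add' := fun a b => by
        ext i; refine Fin.cases ?_ (fun j => ?_) i <;> simp [boundaryIncl]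
      map_smul' := fun a b => by
        ext i; refine Fin.cases ?_ (fun j => ?_) i <;> simp [boundaryIncl] }

/-- The projection of `ℝ^(n+1)` onto the last `n` coordinates. -/
def tailL (n : ℕ) : Vec n →L[ℝ] EuclideanSpace ℝ (Fin n) :=
  LinearMap.toContinuousLinearMap
    { toFun := fun y => WithLp.toLp 2 fun i => y i.succ
      map_add' := fun a b => by ext i; simp
      map_smul' := fun a b => by ext i; simp }

theorem inclL_apply (z : EuclideanSpace ℝ (Fin n)) : inclL n z = boundaryIncl z := rfl

theorem tailL_boundaryIncl (z : EuclideanSpace ℝ (Fin n)) : tailL n (boundaryIncl z) = z := rfl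

theorem boundaryIncl_tailL {y : Vec n} (hy : y 0 = 0) : boundaryIncl (tailL n y) = y := by
  ext i
  refine Fin.cases ?_ (fun j => ?_) i
  · exact hy.symm
  · rfl

theorem inclL_single (i : Fin n) : inclL n (EuclideanSpace.single i 1) = coordVec i.succ := by
  ext j
  refine Fin.cases ?_ (fun j => ?_) j
  · simp [inclL_apply, boundaryIncl, coordVec]
  · simp [inclL_apply, boundaryIncl, coordVec]

theorem measurableSet_target (x : M) : MeasurableSet (extChartAt (𝓡∂ (n + 1)) x).target := by
  have hopen : IsOpen ((𝓡∂ (n + 1)).symm ⁻¹' (chartAt (EuclideanHalfSpace (n + 1)) x).target) :=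
    (chartAt _ x).open_target.preimage (𝓡∂ (n + 1)).continuous_symm
  rw [extChartAt_target]
  exact hopen.measurableSet.inter (𝓡∂ (n + 1)).isClosed_range.measurableSet

variable [IsManifold (𝓡∂ (n + 1)) ∞ M]

theorem volumeDensity_transition (g : Metric n M) {x x' : M} {y : Vec n}
    (hy : y ∈ overlap x x') :
    volumeDensity g x y =
      |(fderivWithin ℝ (transition x x') (range (𝓡∂ (n + 1))) y).det| *
        volumeDensity g x' (transition x x' y) := by
  set D := fderivWithin ℝ (transition x x') (range (𝓡∂ (n + 1))) y with hD
  have h := det_gram_comp (gramForm g x' (transition x x' y)).toLinearMap₁₂ LinearMap.id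
    D.toLinearMap
  rw [volumeDensity, volumeDensity, ← Real.sqrt_sq_eq_abs, ← Real.sqrt_mul (sq_nonneg _)]
  congr 1
  refine Eq.trans ?_ h
  congr 1
  ext i j
  exact chartMetric_transition g hy _ _

theorem transition_boundaryIncl {x x' : M} {z : EuclideanSpace ℝ (Fin n)}
    (hz : boundaryIncl z ∈ overlap x x') :
    boundaryIncl (tailL n (transition x x' (boundaryIncl z))) = transition x x' (boundaryIncl z) :=
  boundaryIncl_tailL (transition_zero_eq_zero hz rfl)

theorem boundaryDensity_transition (g : Metric n M) {x x' : M} {z : EuclideanSpace ℝ (Fin n)}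
    (hz : boundaryIncl z ∈ overlap x x') :
    boundaryDensity g x (boundaryIncl z) =
      |((tailL n).comp ((fderivWithin ℝ (transition x x') (range (𝓡∂ (n + 1)))
        (boundaryIncl z)).comp (inclL n))).det| *
        boundaryDensity g x' (transition x x' (boundaryIncl z)) := by
  set D := fderivWithin ℝ (transition x x') (range (𝓡∂ (n + 1))) (boundaryIncl z) with hD
  have h := det_gram_comp (gramForm g x' (transition x x' (boundaryIncl z))).toLinearMap₁₂
    (inclL n).toLinearMap ((tailL n).comp (D.comp (inclL n))).toLinearMap
  rw [boundaryDensity, boundaryDensity, ← Real.sqrt_sq_eq_abs, ← Real.sqrt_mul (sq_nonneg _)]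
  congr 1
  -- `D` maps vectors tangent to the boundary to tangent vectors, so dropping the zeroth coordinate
  -- loses nothing.
  have hincl (v : EuclideanSpace ℝ (Fin n)) : inclL n (tailL n (D (inclL n v))) = D (inclL n v) :=
    boundaryIncl_tailL (fderivWithin_transition_tangent hz (transition_zero_eq_zero hz rfl) rfl)
  have e1 : (Matrix.of fun i j : Fin n => chartMetric g x (boundaryIncl z) (coordVec i.succ)
      (coordVec j.succ)) = Matrix.of fun i j : Fin n =>
      gramForm g x' (transition x x' (boundaryIncl z))
        (inclL n (tailL n (D (inclL n (EuclideanSpace.single i 1)))))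
        (inclL n (tailL n (D (inclL n (EuclideanSpace.single j 1))))) := by
    ext i j
    rw [Matrix.of_apply, Matrix.of_apply, hincl, hincl, inclL_single, inclL_single]
    exact chartMetric_transition g hz _ _
  have e2 : (Matrix.of fun i j : Fin n => chartMetric g x' (transition x x' (boundaryIncl z))
      (coordVec i.succ) (coordVec j.succ)) = Matrix.of fun i j : Fin n =>
      gramForm g x' (transition x x' (boundaryIncl z))
        (inclL n (EuclideanSpace.single i 1)) (inclL n (EuclideanSpace.single j 1)) := by
    ext i j
    rw [Matrix.of_apply, Matrix.of_apply, inclL_single, inclL_single]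
    rfl
  rw [e1, e2]
  exact h

variable [MeasurableSpace M] [BorelSpace M]

theorem restrict_chartVolume_le (g : Metric n M) (x x' : M) :
    (chartVolume g x).restrict (extChartAt (𝓡∂ (n + 1)) x').source ≤ chartVolume g x' := by
  refine restrict_map_withDensity_le volume (measurableSet_target x) (measurableSet_target x')
    (continuousOn_extChartAt_symm x) (continuousOn_extChartAt_symm x')
    (isOpen_extChartAt_source x').measurableSet (σ := transition x x')
    (σ' := fderivWithin ℝ (transition x x') (range (𝓡∂ (n + 1)))) (fun y hy => ?_)
    (injOn_transition x x') (fun y hy => transition_mem_target hy) (fun y hy => symm_transition hy)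
    fun y hy => ?_
  · exact (differentiableWithinAt_transition hy).hasFDerivWithinAt.mono (overlap_subset_range x x')
  · rw [volumeDensity_transition g hy, ENNReal.ofReal_mul (abs_nonneg _)]

theorem restrict_chartBoundaryVolume_le (g : Metric n M) (x x' : M) :
    (chartBoundaryVolume g x).restrict (extChartAt (𝓡∂ (n + 1)) x').source ≤
      chartBoundaryVolume g x' := by
  have hcont : Continuous (boundaryIncl : EuclideanSpace ℝ (Fin n) → Vec n) := (inclL n).continuous
  have hψ (x : M) : ContinuousOn (fun z => (extChartAt (𝓡∂ (n + 1)) x).symm (boundaryIncl z))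
      (boundaryIncl ⁻¹' (extChartAt (𝓡∂ (n + 1)) x).target) :=
    (continuousOn_extChartAt_symm x).comp hcont.continuousOn fun z hz => hz
  refine restrict_map_withDensity_le volume (hcont.measurable (measurableSet_target x))
    (hcont.measurable (measurableSet_target x')) (hψ x) (hψ x')
    (isOpen_extChartAt_source x').measurableSet
    (σ := fun z => tailL n (transition x x' (boundaryIncl z)))
    (σ' := fun z => (tailL n).comp ((fderivWithin ℝ (transition x x') (range (𝓡∂ (n + 1)))
        (boundaryIncl z)).comp (inclL n))) (fun z hz => ?_) ?_ (fun z hz => ?_) (fun z hz => ?_)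
    fun z hz => ?_
  · have hz' : boundaryIncl z ∈ overlap x x' := hz
    exact (tailL n).hasFDerivAt.comp_hasFDerivWithinAt z
      ((differentiableWithinAt_transition hz').hasFDerivWithinAt.comp z
        (inclL n).hasFDerivWithinAt fun w _ => mem_range_model.2 le_rfl)
  · intro z hz w hw hzw
    have hz' : boundaryIncl z ∈ overlap x x' := hz
    have hw' : boundaryIncl w ∈ overlap x x' := hw
    have h := congrArg boundaryIncl hzw
    rw [transition_boundaryIncl hz', transition_boundaryIncl hw'] at h
    have := injOn_transition x x' hz' hw' h
    rw [← tailL_boundaryIncl z, this, tailL_boundaryIncl]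
  · have hz' : boundaryIncl z ∈ overlap x x' := hz
    rw [mem_preimage, transition_boundaryIncl hz']
    exact transition_mem_target hz'
  · have hz' : boundaryIncl z ∈ overlap x x' := hz
    rw [transition_boundaryIncl hz']
    exact symm_transition hz'
  · have hz' : boundaryIncl z ∈ overlap x x' := hz
    rw [boundaryDensity_transition g hz', ENNReal.ofReal_mul (abs_nonneg _),
      transition_boundaryIncl hz']

theorem isFiniteMeasure_volumeMeasure [CompactSpace M] (g : Metric n M) :
    IsFiniteMeasure (volumeMeasure g) := by
  refine isFiniteMeasure_iSup _ (fun x => (extChartAt (𝓡∂ (n + 1)) x).source)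
    (restrict_chartVolume_le g) fun x => ?_
  obtain ⟨R, hR, C, hC, c, hc, hb⟩ := exists_gramForm_bounds g (mem_extChartAt_target x)
  have hUo : IsOpen ((extChartAt (𝓡∂ (n + 1)) x).source ∩
      extChartAt (𝓡∂ (n + 1)) x ⁻¹' Metric.ball (extChartAt (𝓡∂ (n + 1)) x x) R) :=
    isOpen_extChartAt_preimage' x Metric.isOpen_ball
  refine ⟨_, hUo, ⟨mem_extChartAt_source x, Metric.mem_ball_self hR⟩, inter_subset_left, ?_⟩
  have hsub (y : Vec n) (hy : y ∈ (extChartAt (𝓡∂ (n + 1)) x).target ∩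
      (extChartAt (𝓡∂ (n + 1)) x).symm ⁻¹' ((extChartAt (𝓡∂ (n + 1)) x).source ∩
        extChartAt (𝓡∂ (n + 1)) x ⁻¹' Metric.ball (extChartAt (𝓡∂ (n + 1)) x x) R)) :
      y ∈ Metric.ball (extChartAt (𝓡∂ (n + 1)) x x) R := by
    have := hy.2.2
    rwa [mem_preimage, (extChartAt (𝓡∂ (n + 1)) x).right_inv hy.1] at this
  refine map_withDensity_lt_top volume (measurableSet_target x) (continuousOn_extChartAt_symm x)
    hUo.measurableSet measure_ball_lt_top hsub
    (C := ENNReal.ofReal √(((n + 1).factorial : ℝ) * C ^ (n + 1))) ENNReal.ofReal_lt_top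
    fun y hy => ENNReal.ofReal_le_ofReal (sqrt_det_le _ fun i j => ?_)
  have := (hb y (extChartAt_target_subset_range x hy.1) (Metric.mem_ball.1 (hsub y hy)).le).2.1
    (coordVec i) (coordVec j)
  simpa [coordVec, gramForm_apply] using this

theorem isFiniteMeasure_boundaryMeasure [CompactSpace M] (g : Metric n M) :
    IsFiniteMeasure (boundaryMeasure g) := by
  refine isFiniteMeasure_iSup _ (fun x => (extChartAt (𝓡∂ (n + 1)) x).source)
    (restrict_chartBoundaryVolume_le g) fun x => ?_
  have hcont : Continuous (boundaryIncl : EuclideanSpace ℝ (Fin n) → Vec n) := (inclL n).continuous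
  have hψ : ContinuousOn (fun z => (extChartAt (𝓡∂ (n + 1)) x).symm (boundaryIncl z))
      (boundaryIncl ⁻¹' (extChartAt (𝓡∂ (n + 1)) x).target) :=
    (continuousOn_extChartAt_symm x).comp hcont.continuousOn fun z hz => hz
  obtain ⟨R, hR, C, hC, c, hc, hb⟩ := exists_gramForm_bounds g (mem_extChartAt_target x)
  have hUo : IsOpen ((extChartAt (𝓡∂ (n + 1)) x).source ∩
      extChartAt (𝓡∂ (n + 1)) x ⁻¹' Metric.ball (extChartAt (𝓡∂ (n + 1)) x x) R) :=
    isOpen_extChartAt_preimage' x Metric.isOpen_ball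
  refine ⟨_, hUo, ⟨mem_extChartAt_source x, Metric.mem_ball_self hR⟩, inter_subset_left, ?_⟩
  have hsub (z : EuclideanSpace ℝ (Fin n))
      (hz : z ∈ boundaryIncl ⁻¹' (extChartAt (𝓡∂ (n + 1)) x).target ∩
      (fun z => (extChartAt (𝓡∂ (n + 1)) x).symm (boundaryIncl z)) ⁻¹'
        ((extChartAt (𝓡∂ (n + 1)) x).source ∩
        extChartAt (𝓡∂ (n + 1)) x ⁻¹' Metric.ball (extChartAt (𝓡∂ (n + 1)) x x) R)) :
      boundaryIncl z ∈ Metric.ball (extChartAt (𝓡∂ (n + 1)) x x) R := by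
    have := hz.2.2
    rwa [mem_preimage, (extChartAt (𝓡∂ (n + 1)) x).right_inv hz.1] at this
  have hbdd : Bornology.IsBounded (tailL n '' Metric.ball (extChartAt (𝓡∂ (n + 1)) x x) R) :=
    (tailL n).lipschitz.isBounded_image Metric.isBounded_ball
  refine map_withDensity_lt_top volume (hcont.measurable (measurableSet_target x)) hψ
    hUo.measurableSet hbdd.measure_lt_top (fun z hz => ⟨_, hsub z hz, tailL_boundaryIncl z⟩)
    (C := ENNReal.ofReal √((n.factorial : ℝ) * C ^ n)) ENNReal.ofReal_lt_top
    fun z hz => ENNReal.ofReal_le_ofReal (sqrt_det_le _ fun i j => ?_)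
  have := (hb _ (extChartAt_target_subset_range x hz.1) (Metric.mem_ball.1 (hsub z hz)).le).2.1
    (coordVec i.succ) (coordVec j.succ)
  simpa [coordVec, gramForm_apply] using this

end Riemannian

/-! ### Coordinate balls as building blocks -/

section Pieces

variable {n : ℕ} {M : Type*} [TopologicalSpace M] [ChartedSpace (EuclideanHalfSpace (n + 1)) M]
  [IsManifold (𝓡∂ (n + 1)) ∞ M]

/-- `B` is an open set with closure in `K` whose smooth boundary `K \ B` meets `∂M` transversally,
and there is a convex function around `K`. -/
structure IsPiece (g : Metric n M) (B K : Set M) : Prop where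
  isOpen : IsOpen B
  isClosed : IsClosed K
  subset : B ⊆ K
  mem_closure : ∀ q ∈ K \ B, q ∈ closure ((closure B \ B) ∩ (𝓡∂ (n + 1)).interior M)
  exists_defining : ∃ O, IsOpen O ∧ K ⊆ O ∧ ∃ φ : M → ℝ,
    ContMDiffOn (𝓡∂ (n + 1)) 𝓘(ℝ, ℝ) ∞ φ O ∧ (∀ q ∈ O, q ∈ B ↔ φ q < 0) ∧
    (∀ q ∈ O, q ∈ K \ B ↔ φ q = 0) ∧ ∀ q ∈ K \ B,
      mfderiv (𝓡∂ (n + 1)) 𝓘(ℝ, ℝ) φ q ≠ 0 ∧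
      (q ∈ (𝓡∂ (n + 1)).boundary M →
        LinearMap.ker (mfderiv (𝓡∂ (n + 1)) 𝓘(ℝ, ℝ) φ q).toLinearMap ⊔
          boundaryTangentSpace q = ⊤)
  exists_convex : ∃ O, IsOpen O ∧ K ⊆ O ∧ ∃ f : M → ℝ, ∃ c > 0,
    ContMDiffOn (𝓡∂ (n + 1)) 𝓘(ℝ, ℝ) ∞ f O ∧ ∀ q ∈ K, IsConvexAt g f c q

/-- A kernel of a nonzero functional is a hyperplane, so a single vector of `S` outside it proves
transversality. -/
theorem ker_sup_eq_top {V : Type*} [AddCommGroup V] [Module ℝ V] (l : V →ₗ[ℝ] ℝ)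
    (S : Submodule ℝ V) {w : V} (hw : w ∈ S) (hl : l w ≠ 0) : LinearMap.ker l ⊔ S = ⊤ := by
  refine eq_top_iff.2 fun v _ => Submodule.mem_sup.2
    ⟨v - (l v / l w) • w, ?_, (l v / l w) • w, S.smul_mem _ hw, sub_add_cancel _ _⟩
  rw [LinearMap.mem_ker, map_sub, map_smul, smul_eq_mul, div_mul_cancel₀ _ hl, sub_self]

/-- Rotate `y` about `p` towards `e 0`, which is orthogonal to `y - p`: the arc stays on the sphere
and enters the open half-space at once. This is needed because `innerBoundary` is a closure of
interior points. -/
theorem mem_closure_sphere_pos {p y : Vec n} {r : ℝ} (hr : 0 < r) (hp : p 0 = 0) (hy : y 0 = 0)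
    (hyr : ‖y - p‖ = r) : y ∈ closure {z : Vec n | ‖z - p‖ = r ∧ 0 < z 0} := by
  let γ : ℝ → Vec n := fun θ => p + (Real.cos θ • (y - p) +
    (r * Real.sin θ) • EuclideanSpace.single 0 1)
  have hγ : Continuous γ := by fun_prop
  have h0 : γ 0 = y := by simp [γ]
  have ht : Tendsto γ (𝓝[>] 0) (𝓝 y) := h0 ▸ hγ.continuousAt.tendsto.mono_left nhdsWithin_le_nhds
  refine mem_closure_of_tendsto ht ?_
  filter_upwards [Ioo_mem_nhdsGT Real.pi_pos] with θ hθ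
  have hs := Real.sin_pos_of_mem_Ioo hθ
  constructor
  · have horth : inner ℝ (Real.cos θ • (y - p))
        ((r * Real.sin θ) • (EuclideanSpace.single 0 1 : Vec n)) = 0 := by
      rw [real_inner_smul_left, real_inner_smul_right, EuclideanSpace.inner_single_right]
      simp [hp, hy]
    have h1 : γ θ - p = Real.cos θ • (y - p) +
        (r * Real.sin θ) • EuclideanSpace.single 0 1 := add_sub_cancel_left _ _
    have h2 := norm_add_sq_eq_norm_sq_add_norm_sq_of_inner_eq_zero _ _ horth
    rw [h1]
    have h3 : ‖Real.cos θ • (y - p) + (r * Real.sin θ) •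
        (EuclideanSpace.single 0 1 : Vec n)‖ ^ 2 = r ^ 2 := by
      rw [sq, h2, norm_smul, norm_smul, hyr, PiLp.norm_single]
      simp only [Real.norm_eq_abs, norm_one, mul_one, abs_mul, abs_of_pos hr]
      have e1 := sq_abs (Real.cos θ)
      have e2 := sq_abs (Real.sin θ)
      have e3 := Real.sin_sq_add_cos_sq θ
      linear_combination r ^ 2 * e1 + r ^ 2 * e2 + r ^ 2 * e3
    exact (pow_left_inj₀ (norm_nonneg _) hr.le two_ne_zero).1 h3
  · simp only [γ, PiLp.add_apply, PiLp.smul_apply, PiLp.sub_apply, hp, hy, smul_eq_mul]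
    simp
    positivity

theorem hasFDerivAt_norm_sub_sq (p y : Vec n) (r : ℝ) :
    HasFDerivAt (fun z : Vec n => ‖z - p‖ ^ 2 - r ^ 2) (2 • innerSL ℝ (y - p)) y := by
  have h := (((hasFDerivAt_id y).sub_const p).norm_sq).sub_const (r ^ 2)
  refine h.congr_fderiv ?_
  ext v
  simp

theorem contDiff_norm_sub_sq (p : Vec n) (r : ℝ) :
    ContDiff ℝ ∞ (fun z : Vec n => ‖z - p‖ ^ 2 - r ^ 2) :=
  ((contDiff_id.sub contDiff_const).norm_sq ℝ).sub contDiff_const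

/-- The points of a chart whose coordinates lie in `A`. -/
def chartPreimage (x : M) (A : Set (Vec n)) : Set M :=
  (extChartAt (𝓡∂ (n + 1)) x).source ∩ extChartAt (𝓡∂ (n + 1)) x ⁻¹' A

theorem isPiece_ball [T2Space M] (g : Metric n M) (x : M) {p : Vec n}
    (hp : p ∈ (extChartAt (𝓡∂ (n + 1)) x).target) :
    ∃ R > 0, (∀ y ∈ range (𝓡∂ (n + 1)), dist y p ≤ R → y ∈ (extChartAt (𝓡∂ (n + 1)) x).target) ∧
      ∀ r, 0 < r → r ≤ R → (p 0 = 0 ∨ r < p 0) →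
      IsPiece g (chartPreimage x (Metric.ball p r)) (chartPreimage x (Metric.closedBall p r)) := by
  obtain ⟨R, hR, c, hc, F, hF, hT, hconv⟩ := exists_isConvexAt g hp
  refine ⟨R, hR, hT, fun r hr hrR hpr => ?_⟩
  have hpH := extChartAt_target_subset_range x hp
  have hKT : Metric.closedBall p r ∩ range (𝓡∂ (n + 1)) ⊆ (extChartAt (𝓡∂ (n + 1)) x).target :=
    fun y hy => hT y hy.2 ((Metric.mem_closedBall.1 hy.1).trans hrR)
  have hdiff (q : M) : q ∈ chartPreimage x (Metric.closedBall p r) \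
      chartPreimage x (Metric.ball p r) ↔ q ∈ (extChartAt (𝓡∂ (n + 1)) x).source ∧
        ‖extChartAt (𝓡∂ (n + 1)) x q - p‖ = r := by
    simp only [chartPreimage, Set.mem_sdiff, mem_inter_iff, mem_preimage, Metric.mem_closedBall,
      Metric.mem_ball, dist_eq_norm]
    constructor
    · rintro ⟨⟨h1, h2⟩, h3⟩
      exact ⟨h1, le_antisymm h2 (not_lt.1 fun h => h3 ⟨h1, h⟩)⟩
    · rintro ⟨h1, h2⟩
      exact ⟨⟨h1, h2.le⟩, fun h => h.2.ne h2⟩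
  have hclosure (z : Vec n) (hz : z ∈ range (𝓡∂ (n + 1))) (hzr : ‖z - p‖ = r) :
      (extChartAt (𝓡∂ (n + 1)) x).symm z ∈ closure (chartPreimage x (Metric.ball p r)) := by
    have hzT := hKT ⟨Metric.mem_closedBall.2 (dist_eq_norm z p ▸ hzr.le), hz⟩
    -- A sphere point is approached along the radius, which stays in the half-space by convexity.
    have hseg : openSegment ℝ p z ⊆ Metric.ball p r ∩ (extChartAt (𝓡∂ (n + 1)) x).target := by
      rintro w hw
      have hwH := (𝓡∂ (n + 1)).convex_range.openSegment_subset hpH hz hw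
      rw [openSegment_eq_image'] at hw
      obtain ⟨t, ht, rfl⟩ := hw
      have hd : dist (p + t • (z - p)) p < r := by
        rw [dist_eq_norm, add_sub_cancel_left, norm_smul, hzr, Real.norm_eq_abs, abs_of_pos ht.1]
        nlinarith [ht.2]
      exact ⟨hd, hT _ hwH (hd.le.trans hrR)⟩
    refine ContinuousWithinAt.mem_closure
      (((continuousOn_extChartAt_symm x) z hzT).mono (hseg.trans inter_subset_right))
      (segment_subset_closure_openSegment (right_mem_segment ℝ p z)) fun w hw => ?_
    refine ⟨(extChartAt (𝓡∂ (n + 1)) x).map_target (hseg hw).2, ?_⟩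
    rw [mem_preimage, (extChartAt (𝓡∂ (n + 1)) x).right_inv (hseg hw).2]
    exact (hseg hw).1
  refine ⟨isOpen_extChartAt_preimage' x Metric.isOpen_ball, ?_, ?_, fun q hq => ?_,
    ⟨_, isOpen_extChartAt_source x, inter_subset_left,
      (fun z => ‖z - p‖ ^ 2 - r ^ 2) ∘ extChartAt (𝓡∂ (n + 1)) x,
      contMDiffOn_comp_extChartAt (contDiff_norm_sub_sq p r) x, fun q hq => ?_, fun q hq => ?_,
      fun q hq => ?_⟩,
    ⟨_, isOpen_extChartAt_source x, inter_subset_left, _, c, hc,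
      contMDiffOn_comp_extChartAt hF x, fun q hq => hconv q hq.1 (hq.2.trans hrR)⟩⟩
  -- Closedness is needed in `M`, not just in the chart domain: the set is the continuous image of a
  -- compact half-ball, and `M` is Hausdorff.
  · have heq : chartPreimage x (Metric.closedBall p r) = (extChartAt (𝓡∂ (n + 1)) x).symm ''
        (Metric.closedBall p r ∩ range (𝓡∂ (n + 1))) := by
      ext q
      constructor
      · exact fun hq => ⟨_, ⟨hq.2, extChartAt_target_subset_range x
          ((extChartAt (𝓡∂ (n + 1)) x).map_source hq.1)⟩, (extChartAt (𝓡∂ (n + 1)) x).left_inv hq.1⟩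
      · rintro ⟨z, hz, rfl⟩
        refine ⟨(extChartAt (𝓡∂ (n + 1)) x).map_target (hKT hz), ?_⟩
        rw [mem_preimage, (extChartAt (𝓡∂ (n + 1)) x).right_inv (hKT hz)]
        exact hz.1
    rw [heq]
    exact (((isCompact_closedBall p r).inter_right (𝓡∂ (n + 1)).isClosed_range).image_of_continuousOn
      ((continuousOn_extChartAt_symm x).mono hKT)).isClosed
  · exact inter_subset_inter_right _ (preimage_mono Metric.ball_subset_closedBall)
  · obtain ⟨hqs, hqr⟩ := (hdiff q).1 hq
    have hqT := (extChartAt (𝓡∂ (n + 1)) x).map_source hqs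
    have hy0 := nonneg_of_mem_target hqT
    have hmaps (z : Vec n) (hz : ‖z - p‖ = r) (hz0 : 0 < z 0) :
        (extChartAt (𝓡∂ (n + 1)) x).symm z ∈ (closure (chartPreimage x (Metric.ball p r)) \
          chartPreimage x (Metric.ball p r)) ∩ (𝓡∂ (n + 1)).interior M := by
      have hzH := mem_range_model.2 hz0.le
      have hzT := hKT ⟨Metric.mem_closedBall.2 (dist_eq_norm z p ▸ hz.le), hzH⟩
      have hzs := (extChartAt (𝓡∂ (n + 1)) x).map_target hzT
      have hzi := (extChartAt (𝓡∂ (n + 1)) x).right_inv hzT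
      refine ⟨⟨hclosure z hzH hz, fun h => ?_⟩, ?_⟩
      · have := h.2
        rw [mem_preimage, hzi, Metric.mem_ball, dist_eq_norm] at this
        exact this.ne hz
      · rw [← ModelWithCorners.compl_boundary, mem_compl_iff, isBoundaryPoint_iff_chart hzs, hzi]
        exact hz0.ne'
    have hqi := (extChartAt (𝓡∂ (n + 1)) x).left_inv hqs
    rcases hy0.eq_or_lt with h0 | h0
    · have hp0 : p 0 = 0 := by
        -- A ball of radius `r < p 0` stays off the hyperplane `y 0 = 0`, so a sphere point on the
        -- boundary forces the centre onto it.
        refine hpr.resolve_right fun hlt => ?_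
        have h1 := PiLp.norm_apply_le (extChartAt (𝓡∂ (n + 1)) x q - p) 0
        rw [hqr, PiLp.sub_apply, ← h0, zero_sub, norm_neg, Real.norm_eq_abs] at h1
        exact absurd ((le_abs_self _).trans h1) (not_le.2 hlt)
      rw [← hqi]
      have hsub : {z : Vec n | ‖z - p‖ = r ∧ 0 < z 0} ⊆ (extChartAt (𝓡∂ (n + 1)) x).target :=
        fun z hz => hKT ⟨Metric.mem_closedBall.2 (dist_eq_norm z p ▸ hz.1.le),
          mem_range_model.2 hz.2.le⟩
      exact ContinuousWithinAt.mem_closure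
        (((continuousOn_extChartAt_symm x) _ hqT).mono hsub)
        (mem_closure_sphere_pos hr hp0 h0.symm hqr) fun z hz => hmaps z hz.1 hz.2
    · rw [← hqi]
      exact subset_closure (hmaps _ hqr h0)
  · simp only [chartPreimage, mem_inter_iff, mem_preimage, hq, true_and, Metric.mem_ball,
      dist_eq_norm, Function.comp_apply, sub_neg]
    exact (pow_lt_pow_iff_left₀ (norm_nonneg _) hr.le two_ne_zero).symm
  · rw [hdiff]
    simp only [hq, true_and, Function.comp_apply, sub_eq_zero]
    exact (pow_left_inj₀ (norm_nonneg _) hr.le two_ne_zero).symm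
  · obtain ⟨hqs, hqr⟩ := (hdiff q).1 hq
    -- On the radial vector the differential is `2 * r ^ 2`. At a boundary point that vector is
    -- tangent to `∂M`, since `p 0 = 0`, so it gives transversality too.
    have hval : mfderiv (𝓡∂ (n + 1)) 𝓘(ℝ, ℝ)
        ((fun z => ‖z - p‖ ^ 2 - r ^ 2) ∘ extChartAt (𝓡∂ (n + 1)) x) q
        (frame x (extChartAt (𝓡∂ (n + 1)) x q) (extChartAt (𝓡∂ (n + 1)) x q - p) : Vec n) ≠
        (0 : ℝ) := by
      rw [mfderiv_comp_extChartAt_frame (contDiff_norm_sub_sq p r) hqs,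
        (hasFDerivAt_norm_sub_sq p _ r).fderiv]
      have : (2 • innerSL ℝ (extChartAt (𝓡∂ (n + 1)) x q - p))
          (extChartAt (𝓡∂ (n + 1)) x q - p) = 2 * r ^ 2 := by
        rw [smul_apply, innerSL_apply_apply, real_inner_self_eq_norm_sq, hqr, nsmul_eq_mul]
        rfl
      rw [this]
      exact (mul_pos two_pos (pow_pos hr 2)).ne'
    refine ⟨fun h => hval (DFunLike.congr_fun h _), fun hb => ker_sup_eq_top _ _ ?_ hval⟩
    obtain ⟨a, -, ha⟩ := exists_normalCovector_frame hqs hb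
    have h0 := (isBoundaryPoint_iff_chart hqs).1 hb
    have hp0 : p 0 = 0 := by
      refine hpr.resolve_right fun hlt => ?_
      have h1 := PiLp.norm_apply_le (extChartAt (𝓡∂ (n + 1)) x q - p) 0
      rw [hqr, PiLp.sub_apply, h0, zero_sub, norm_neg, Real.norm_eq_abs] at h1
      exact absurd ((le_abs_self _).trans h1) (not_le.2 hlt)
    refine LinearMap.mem_ker.2 ((ha _).trans ?_)
    rw [PiLp.sub_apply, h0, hp0, sub_zero, mul_zero]

end Pieces

/-! ### Filling `M` with disjoint pieces up to small measure -/

section Covering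

/-- Continuity from above of the finite measure `ν` along the finite subfamilies. -/
theorem exists_finset_measure_diff_lt {X ι : Type*} [MeasurableSpace X] (ν : Measure X)
    [IsFiniteMeasure ν] {O : Set X} (hO : MeasurableSet O) {t : Set ι} (ht : t.Countable)
    {B : ι → Set X} (hB : ∀ i ∈ t, MeasurableSet (B i)) (h : ν (O \ ⋃ i ∈ t, B i) = 0)
    {δ : ℝ≥0∞} (hδ : δ ≠ 0) :
    ∃ u : Finset ι, ↑u ⊆ t ∧ ν (O \ ⋃ i ∈ u, B i) < δ := by
  classical
  have := ht.to_subtype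
  let A : Finset t → Set X := fun u => O \ ⋃ i ∈ u, B i
  have hA : Antitone A := fun u v huv => sdiff_subset_sdiff_right (biUnion_subset_biUnion_left huv)
  have hlim := tendsto_measure_iInter_atTop (μ := ν) (s := A)
    (fun u => (hO.diff (u.measurableSet_biUnion fun i _ => hB i i.2)).nullMeasurableSet) hA
    ⟨∅, measure_ne_top _ _⟩
  have h0 : ν (⋂ u, A u) = 0 := by
    refine measure_mono_null (fun x hx => ?_) h
    rw [mem_iInter] at hx
    refine ⟨(hx ∅).1, fun hxt => ?_⟩
    obtain ⟨i, hi, hxi⟩ := mem_iUnion₂.1 hxt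
    exact (hx {⟨i, hi⟩}).2 (by simpa using hxi)
  rw [h0] at hlim
  obtain ⟨u, hu⟩ := (hlim.eventually (gt_mem_nhds (pos_iff_ne_zero.2 hδ))).exists
  refine ⟨u.map (Function.Embedding.subtype _), by simp, ?_⟩
  simpa [A] using hu

variable {n : ℕ} {M : Type*} [TopologicalSpace M] [ChartedSpace (EuclideanHalfSpace (n + 1)) M]
  [IsManifold (𝓡∂ (n + 1)) ∞ M] [MeasurableSpace M] [BorelSpace M] [T2Space M]

/-- A finite disjoint family of pieces inside `O`. -/
structure IsFamily (g : Metric n M) (ν : Measure M) (O : Set M) (t : Finset (Set M × Set M)) :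
    Prop where
  isPiece : ∀ P ∈ t, IsPiece g P.1 P.2
  subset : ∀ P ∈ t, P.2 ⊆ O
  measure_diff : ∀ P ∈ t, ν (P.2 \ P.1) = 0
  pairwiseDisjoint : (t : Set (Set M × Set M)).PairwiseDisjoint Prod.snd

theorem exists_isFamily_of_subset_source (g : Metric n M) (ν : Measure M) [IsFiniteMeasure ν]
    {x : M} {O : Set M} (hO : IsOpen O) (hOx : O ⊆ (extChartAt (𝓡∂ (n + 1)) x).source)
    {δ : ℝ≥0∞} (hδ : δ ≠ 0) :
    ∃ t, IsFamily g ν O t ∧ ν (O \ ⋃ P ∈ t, P.1) < δ := by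
  classical
  have hs := (isOpen_extChartAt_source (I := 𝓡∂ (n + 1)) x).measurableSet
  have hφ : AEMeasurable (extChartAt (𝓡∂ (n + 1)) x)
      (ν.restrict (extChartAt (𝓡∂ (n + 1)) x).source) :=
    (continuousOn_extChartAt x).aemeasurable hs
  set μ := (ν.restrict (extChartAt (𝓡∂ (n + 1)) x).source).map (extChartAt (𝓡∂ (n + 1)) x) with hμ
  -- `Measure.le_map_apply` holds for arbitrary sets, so the exceptional set of the covering theorem
  -- needs no measurability.
  have hnull (A : Set (Vec n)) (hA : μ A = 0) : ν (chartPreimage x A) = 0 := by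
    have h := Measure.le_map_apply hφ A
    rw [← hμ, hA, Measure.restrict_apply' hs, inter_comm] at h
    exact le_antisymm h zero_le
  let s : Set (Vec n) := (extChartAt (𝓡∂ (n + 1)) x).target ∩
    (extChartAt (𝓡∂ (n + 1)) x).symm ⁻¹' O
  let adm : Vec n → Set ℝ := fun p => {r |
    IsPiece g (chartPreimage x (Metric.ball p r)) (chartPreimage x (Metric.closedBall p r)) ∧
    chartPreimage x (Metric.closedBall p r) ⊆ O ∧ μ (Metric.closedBall p r \ Metric.ball p r) = 0}
  have hadm : ∀ p ∈ s, ∀ η > 0, (adm p ∩ Ioo 0 η).Nonempty := by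
    intro p hp η hη
    obtain ⟨R, hR, -, hpiece⟩ := isPiece_ball g x hp.1
    have hsO : s ∈ 𝓝[range (𝓡∂ (n + 1))] p := by
      have h1 := extChartAt_target_mem_nhdsWithin_of_mem (I := 𝓡∂ (n + 1)) hp.1
      exact inter_mem h1 (((continuousOn_extChartAt_symm (I := 𝓡∂ (n + 1)) x p
        hp.1).mono_of_mem_nhdsWithin h1) (hO.mem_nhds hp.2))
    obtain ⟨R', hR', hball⟩ := Metric.mem_nhdsWithin_iff.1 hsO
    obtain ⟨R'', hR'', hp0⟩ : ∃ R'' > 0, p 0 = 0 ∨ R'' ≤ p 0 := by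
      rcases (nonneg_of_mem_target hp.1).eq_or_lt with h | h
      · exact ⟨1, one_pos, Or.inl h.symm⟩
      · exact ⟨p 0, h, Or.inr le_rfl⟩
    -- Spheres of different radii about `p` are disjoint, so a finite measure charges only countably
    -- many of them.
    obtain ⟨r, hr, hrnull⟩ := exists_null_frontier_thickening μ {p}
      (lt_min (lt_min hR hR') (lt_min hR'' hη))
    have hrR : r < R := hr.2.trans_le ((min_le_left _ _).trans (min_le_left _ _))
    have hrR' : r < R' := hr.2.trans_le ((min_le_left _ _).trans (min_le_right _ _))
    have hrR'' : r < R'' := hr.2.trans_le ((min_le_right _ _).trans (min_le_left _ _))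
    have hrη : r < η := hr.2.trans_le ((min_le_right _ _).trans (min_le_right _ _))
    refine ⟨r, ⟨hpiece r hr.1 hrR.le (hp0.imp_right hrR''.trans_le), fun q hq => ?_, ?_⟩, hr.1, hrη⟩
    · have h1 := hball ⟨Metric.mem_ball.2 ((Metric.mem_closedBall.1 hq.2).trans_lt hrR'),
        extChartAt_target_subset_range x ((extChartAt (𝓡∂ (n + 1)) x).map_source hq.1)⟩
      have := h1.2
      rwa [mem_preimage, (extChartAt (𝓡∂ (n + 1)) x).left_inv hq.1] at this
    · rw [Metric.thickening_singleton, frontier_ball p hr.1.ne'] at hrnull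
      rwa [Metric.closedBall_sdiff_ball]
  obtain ⟨t, htc, hts, htadm, htnull, htdisj⟩ :=
    Besicovitch.exists_disjoint_closedBall_covering_ae_aux μ (fun p => adm p ∩ Ioi 0) s
      fun p hp η hη => by
        obtain ⟨r, h1, h2⟩ := hadm p hp η hη
        exact ⟨r, ⟨h1, h2.1⟩, h2⟩
  -- Passing from closed to open balls loses only countably many null spheres.
  have hcover : ν (O \ ⋃ P ∈ t, chartPreimage x (Metric.ball P.1 P.2)) = 0 := by
    have h1 : ν (⋃ P ∈ t, chartPreimage x (Metric.closedBall P.1 P.2 \ Metric.ball P.1 P.2)) = 0 :=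
      (measure_biUnion_null_iff htc).2 fun P hP => hnull _ (htadm P hP).1.2.2
    refine measure_mono_null (fun q hq => ?_) (measure_union_null (hnull _ htnull) h1)
    have hqs := hOx hq.1
    by_cases hK : ∃ P ∈ t, extChartAt (𝓡∂ (n + 1)) x q ∈ Metric.closedBall P.1 P.2
    · obtain ⟨P, hP, hqP⟩ := hK
      refine Or.inr (mem_iUnion₂.2 ⟨P, hP, hqs, hqP, fun hb => hq.2 ?_⟩)
      exact mem_iUnion₂.2 ⟨P, hP, hqs, hb⟩
    · refine Or.inl ⟨hqs, ⟨(extChartAt (𝓡∂ (n + 1)) x).map_source hqs, ?_⟩, fun hU => hK ?_⟩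
      · rw [mem_preimage, (extChartAt (𝓡∂ (n + 1)) x).left_inv hqs]
        exact hq.1
      · obtain ⟨P, hP, hqP⟩ := mem_iUnion₂.1 hU
        exact ⟨P, hP, hqP⟩
  obtain ⟨u, hut, hu⟩ := exists_finset_measure_diff_lt ν hO.measurableSet htc
    (fun P hP => (htadm P hP).1.1.isOpen.measurableSet) hcover hδ
  refine ⟨u.image fun P => (chartPreimage x (Metric.ball P.1 P.2),
    chartPreimage x (Metric.closedBall P.1 P.2)), ⟨?_, ?_, ?_, ?_⟩, ?_⟩
  · simp only [Finset.forall_mem_image]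
    exact fun P hP => (htadm P (hut hP)).1.1
  · simp only [Finset.forall_mem_image]
    exact fun P hP => (htadm P (hut hP)).1.2.1
  · simp only [Finset.forall_mem_image]
    exact fun P hP => measure_mono_null
      (t := chartPreimage x (Metric.closedBall P.1 P.2 \ Metric.ball P.1 P.2))
      (fun q hq => ⟨hq.1.1, hq.1.2, fun h => hq.2 ⟨hq.1.1, h⟩⟩) (hnull _ (htadm P (hut hP)).1.2.2)
  · rw [Finset.coe_image]
    rintro _ ⟨P, hP, rfl⟩ _ ⟨Q, hQ, rfl⟩ hne
    have hPQ : P ≠ Q := fun h => hne (h ▸ rfl)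
    exact Disjoint.mono inter_subset_right inter_subset_right
      ((htdisj (hut hP) (hut hQ) hPQ).preimage _)
  · rwa [Finset.set_biUnion_finset_image]

theorem exists_isFamily (g : Metric n M) (ν : Measure M) [IsFiniteMeasure ν] (u : Finset M)
    {δ : ℝ≥0∞} (hδ : δ ≠ 0) :
    ∃ t, IsFamily g ν univ t ∧
      ν ((⋃ x ∈ u, (extChartAt (𝓡∂ (n + 1)) x).source) \ ⋃ P ∈ t, P.1) < δ := by
  classical
  induction u using Finset.induction_on generalizing δ with
  | empty => exact ⟨∅, ⟨by simp, by simp, by simp, by simp⟩, by simpa using pos_iff_ne_zero.2 hδ⟩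
  | insert a u _ ih =>
    have hδ2 : δ / 2 ≠ 0 := by simpa using hδ
    obtain ⟨t₁, ht₁, hν₁⟩ := ih hδ2
    -- The closed pieces are removed, so the remainder is open and the new pieces are disjoint from
    -- the old ones; only the null sets `P.2 \ P.1` go uncovered on account of this.
    have hOo : IsOpen ((extChartAt (𝓡∂ (n + 1)) a).source \ ⋃ P ∈ t₁, P.2) :=
      (isOpen_extChartAt_source a).sdiff
        (t₁.finite_toSet.isClosed_biUnion fun P hP => (ht₁.isPiece P hP).isClosed)
    obtain ⟨t₂, ht₂, hν₂⟩ := exists_isFamily_of_subset_source g ν hOo sdiff_subset hδ2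
    refine ⟨t₁ ∪ t₂, ⟨?_, fun _ _ => subset_univ _, ?_, ?_⟩, ?_⟩
    · exact fun P hP => (Finset.mem_union.1 hP).elim (ht₁.isPiece P) (ht₂.isPiece P)
    · exact fun P hP => (Finset.mem_union.1 hP).elim (ht₁.measure_diff P) (ht₂.measure_diff P)
    · have hd (P) (hP : P ∈ t₁) (Q) (hQ : Q ∈ t₂) : Disjoint P.2 Q.2 :=
        disjoint_left.2 fun q hqP hqQ => (ht₂.subset Q hQ hqQ).2 (mem_iUnion₂.2 ⟨P, hP, hqP⟩)
      intro P hP Q hQ hne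
      rcases Finset.mem_union.1 hP with hP | hP <;> rcases Finset.mem_union.1 hQ with hQ | hQ
      · exact ht₁.pairwiseDisjoint hP hQ hne
      · exact hd P hP Q hQ
      · exact (hd Q hQ P hP).symm
      · exact ht₂.pairwiseDisjoint hP hQ hne
    · have h0 : ν (⋃ P ∈ t₁, P.2 \ P.1) = 0 :=
        (measure_biUnion_null_iff t₁.countable_toSet).2 ht₁.measure_diff
      calc ν _ ≤ ν ((((⋃ x ∈ u, (extChartAt (𝓡∂ (n + 1)) x).source) \ ⋃ P ∈ t₁, P.1) ∪
            (((extChartAt (𝓡∂ (n + 1)) a).source \ ⋃ P ∈ t₁, P.2) \ ⋃ P ∈ t₂, P.1)) ∪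
            ⋃ P ∈ t₁, P.2 \ P.1) := measure_mono fun q hq => by
              obtain ⟨hq1, hq2⟩ := hq
              simp only [mem_iUnion, exists_prop, Finset.mem_insert, Finset.mem_union, mem_union,
                Set.mem_sdiff, not_exists, not_and] at hq1 hq2 ⊢
              obtain ⟨x, rfl | hx, hqx⟩ := hq1
              · by_cases h : ∃ P ∈ t₁, q ∈ P.2
                · obtain ⟨P, hP, hqP⟩ := h
                  exact Or.inr ⟨P, hP, hqP, hq2 P (Or.inl hP)⟩
                · push Not at h
                  exact Or.inl (Or.inr ⟨⟨hqx, h⟩, fun P hP => hq2 P (Or.inr hP)⟩)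
              · exact Or.inl (Or.inl ⟨⟨x, hx, hqx⟩, fun P hP => hq2 P (Or.inl hP)⟩)
        _ ≤ ν _ + ν _ + 0 := (measure_union_le _ _).trans (add_le_add (measure_union_le _ _) h0.le)
        _ < δ / 2 + δ / 2 := by rw [add_zero]; exact ENNReal.add_lt_add hν₁ hν₂
        _ = δ := ENNReal.add_halves δ

theorem exists_isFamily_compl [CompactSpace M] (g : Metric n M) (ν : Measure M) [IsFiniteMeasure ν]
    {δ : ℝ≥0∞} (hδ : δ ≠ 0) :
    ∃ t, IsFamily g ν univ t ∧ ν (⋃ P ∈ t, P.1)ᶜ < δ := by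
  obtain ⟨u, hu⟩ := isCompact_univ.elim_finite_subcover
    (fun x : M => (extChartAt (𝓡∂ (n + 1)) x).source) (fun x => isOpen_extChartAt_source x)
    fun x _ => mem_iUnion.2 ⟨x, mem_extChartAt_source x⟩
  obtain ⟨t, ht, hν⟩ := exists_isFamily g ν u hδ
  refine ⟨t, ht, lt_of_le_of_lt (measure_mono fun q hq => ?_) hν⟩
  exact ⟨hu (mem_univ q), hq⟩

end Covering

/-! ### Gluing the pieces -/

section Assembly

variable {n : ℕ} {M : Type*} [TopologicalSpace M] [ChartedSpace (EuclideanHalfSpace (n + 1)) M]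
  [IsManifold (𝓡∂ (n + 1)) ∞ M]

theorem closure_biUnion_subset {g : Metric n M} {t : Finset (Set M × Set M)}
    (ht : ∀ P ∈ t, IsPiece g P.1 P.2) : closure (⋃ P ∈ t, P.1) ⊆ ⋃ P ∈ t, P.2 :=
  closure_minimal (iUnion₂_mono fun P hP => (ht P hP).subset)
    (t.finite_toSet.isClosed_biUnion fun P hP => (ht P hP).isClosed)

theorem hasSmoothTransversalBoundary_biUnion {g : Metric n M} {t : Finset (Set M × Set M)}
    (ht : ∀ P ∈ t, IsPiece g P.1 P.2)
    (hd : (t : Set (Set M × Set M)).PairwiseDisjoint Prod.snd) :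
    HasSmoothTransversalBoundary n (⋃ P ∈ t, P.1) := by
  classical
  set V := ⋃ P ∈ t, P.1 with hV
  have hVo : IsOpen V := isOpen_biUnion fun P hP => (ht P hP).isOpen
  have hVcl := closure_biUnion_subset ht
  have hinner : innerBoundary n V ⊆ closure V \ V := by
    rw [← hVo.frontier_eq]
    exact closure_minimal inter_subset_left isClosed_frontier
  intro p hp
  obtain ⟨P, hP, hpP⟩ := mem_iUnion₂.1 (hVcl (hinner hp).1)
  have hpB : p ∉ P.1 := fun h => (hinner hp).2 (mem_iUnion₂.2 ⟨P, hP, h⟩)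
  obtain ⟨O, hO, hKO, φ, hφ, hneg, hzero, hder⟩ := (ht P hP).exists_defining
  -- Off the closed set `Z`, which misses `P.2`, the union `V` is just `P.1`, so the defining
  -- function of `P` serves on `O \ Z`.
  set Z := ⋃ Q ∈ t.erase P, Q.2 with hZ
  have hZc : IsClosed Z := (t.erase P).finite_toSet.isClosed_biUnion
    fun Q hQ => (ht Q (Finset.mem_of_mem_erase hQ)).isClosed
  have hPZ : Disjoint P.2 Z := disjoint_left.2 fun q hq hqZ => by
    obtain ⟨Q, hQ, hqQ⟩ := mem_iUnion₂.1 hqZ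
    exact disjoint_left.1 (hd hP (Finset.mem_of_mem_erase hQ) (Finset.ne_of_mem_erase hQ).symm)
      hq hqQ
  have hnotZ {q : M} (hq : q ∉ Z) {Q : Set M × Set M} (hQ : Q ∈ t) (hqQ : q ∈ Q.2) : Q = P := by
    by_contra hne
    exact hq (mem_iUnion₂.2 ⟨Q, Finset.mem_erase.2 ⟨hne, hQ⟩, hqQ⟩)
  have hVP {q : M} (hq : q ∉ Z) : q ∈ V ↔ q ∈ P.1 := by
    refine ⟨fun h => ?_, fun h => mem_iUnion₂.2 ⟨P, hP, h⟩⟩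
    obtain ⟨Q, hQ, hqQ⟩ := mem_iUnion₂.1 h
    exact hnotZ hq hQ ((ht Q hQ).subset hqQ) ▸ hqQ
  refine ⟨O \ Z, hO.sdiff hZc, ⟨hKO hpP, disjoint_left.1 hPZ hpP⟩, φ, hφ.mono sdiff_subset, ?_, ?_,
    hder p ⟨hpP, hpB⟩⟩
  · ext q
    constructor
    · rintro ⟨hqV, hqU⟩
      exact ⟨hqU, (hneg q hqU.1).1 ((hVP hqU.2).1 hqV)⟩
    · rintro ⟨hqU, hq⟩
      exact ⟨(hVP hqU.2).2 ((hneg q hqU.1).2 hq), hqU⟩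
  · ext q
    constructor
    · rintro ⟨hqV, hqU⟩
      obtain ⟨Q, hQ, hqQ⟩ := mem_iUnion₂.1 (hVcl (hinner hqV).1)
      have hQP := hnotZ hqU.2 hQ hqQ
      subst hQP
      exact ⟨hqU, (hzero q hqU.1).1 ⟨hqQ, fun h => (hinner hqV).2 (mem_iUnion₂.2 ⟨Q, hQ, h⟩)⟩⟩
    · rintro ⟨hqU, hq⟩
      refine ⟨?_, hqU⟩
      refine closure_mono ?_ ((ht P hP).mem_closure q ((hzero q hqU.1).2 hq))
      refine inter_subset_inter_left _ fun z hz => ?_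
      have hzP : z ∈ P.2 := closure_minimal (ht P hP).subset (ht P hP).isClosed hz.1
      rw [hVo.frontier_eq]
      exact ⟨closure_mono (subset_biUnion_of_mem (u := fun P : Set M × Set M => P.1) hP) hz.1,
        fun h => hz.2 ((hVP (disjoint_left.1 hPZ hzP)).1 h)⟩

theorem hessian_congr (g : Metric n M) {f f' : M → ℝ} {q : M} (h : f =ᶠ[𝓝 q] f')
    (X Y : TangentSpace (𝓡∂ (n + 1)) q) : hessian g f q X Y = hessian g f' q X Y := by
  have hy := extChartAt_target_subset_range q (mem_extChartAt_target (I := 𝓡∂ (n + 1)) q)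
  have hgrad : gradient g f q = gradient g f' q := by
    rw [gradient, gradient, h.mfderiv_eq]
  have hcont : Tendsto (extChartAt (𝓡∂ (n + 1)) q).symm
      (𝓝[range (𝓡∂ (n + 1))] (extChartAt (𝓡∂ (n + 1)) q q)) (𝓝 q) := by
    have h1 := (continuousAt_extChartAt_symm (I := 𝓡∂ (n + 1)) q).tendsto
    rw [extChartAt_to_inv] at h1
    exact h1.mono_left nhdsWithin_le_nhds
  have h1 : f ∘ (extChartAt (𝓡∂ (n + 1)) q).symm
      =ᶠ[𝓝[range (𝓡∂ (n + 1))] (extChartAt (𝓡∂ (n + 1)) q q)]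
      f' ∘ (extChartAt (𝓡∂ (n + 1)) q).symm := hcont.eventually h
  have h2 : (fun y => fderivWithin ℝ (f ∘ (extChartAt (𝓡∂ (n + 1)) q).symm)
        (range (𝓡∂ (n + 1))) y (Y : Vec n))
      =ᶠ[𝓝[range (𝓡∂ (n + 1))] (extChartAt (𝓡∂ (n + 1)) q q)]
      fun y => fderivWithin ℝ (f' ∘ (extChartAt (𝓡∂ (n + 1)) q).symm)
        (range (𝓡∂ (n + 1))) y (Y : Vec n) := by
    filter_upwards [h1.fderivWithin' (𝕜 := ℝ) Subset.rfl] with y hy using by rw [hy]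
  have h3 := h2.fderivWithin_eq (𝕜 := ℝ) (h2.self_of_nhdsWithin hy)
  rw [hessian, hessian, hgrad]
  exact congrArg₂ (· - ·) (DFunLike.congr_fun h3 _) rfl

theorem IsConvexAt.congr {g : Metric n M} {f f' : M → ℝ} {c : ℝ} {q : M}
    (hf : IsConvexAt g f c q) (h : f' =ᶠ[𝓝 q] f) : IsConvexAt g f' c q := by
  have hgrad : gradient g f' q = gradient g f q := by
    rw [gradient, gradient, h.mfderiv_eq]
  refine ⟨hf.contMDiffAt.congr_of_eventuallyEq h, fun X => ?_, ?_, ?_, fun hb => ?_⟩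
  · rw [hessian_congr g h]; exact hf.sq_le_hessian X
  · rw [hgrad]; exact hf.le_gradient
  · rw [h.eq_of_nhds]; exact hf.one_le
  · rw [hgrad]; exact hf.inner_lt hb

theorem IsConvexAt.mono {g : Metric n M} {f : M → ℝ} {c c' : ℝ} {q : M}
    (hf : IsConvexAt g f c q) (h : c' ≤ c) : IsConvexAt g f c' q :=
  { hf with le_gradient := h.trans hf.le_gradient }

theorem exists_isConvexAt_biUnion [T2Space M] [CompactSpace M] {g : Metric n M}
    {t : Finset (Set M × Set M)} (ht : ∀ P ∈ t, IsPiece g P.1 P.2)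
    (hd : (t : Set (Set M × Set M)).PairwiseDisjoint Prod.snd) :
    ∃ d : M → ℝ, ContMDiff (𝓡∂ (n + 1)) 𝓘(ℝ, ℝ) ∞ d ∧
      ∃ c > 0, ∀ q ∈ ⋃ P ∈ t, P.2, IsConvexAt g d c q := by
  classical
  have hex (P : Set M × Set M) (hP : P ∈ t) : ∃ h : M → ℝ, ∃ c > 0,
      ContMDiff (𝓡∂ (n + 1)) 𝓘(ℝ, ℝ) ∞ h ∧ (∀ q ∈ P.2, IsConvexAt g h c q) ∧
      ∀ Q ∈ t, Q ≠ P → ∀ q ∈ Q.2, h =ᶠ[𝓝 q] 0 := by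
    obtain ⟨O, hO, hKO, f, c, hc, hf, hconv⟩ := (ht P hP).exists_convex
    have hZc : IsClosed (⋃ Q ∈ t.erase P, Q.2) := (t.erase P).finite_toSet.isClosed_biUnion
      fun Q hQ => (ht Q (Finset.mem_of_mem_erase hQ)).isClosed
    have hdisj : Disjoint ((⋃ Q ∈ t.erase P, Q.2) ∪ Oᶜ) P.2 := by
      refine disjoint_left.2 fun q hq hqP => hq.elim (fun h => ?_) fun h => h (hKO hqP)
      obtain ⟨Q, hQ, hqQ⟩ := mem_iUnion₂.1 h
      exact disjoint_left.1 (hd hP (Finset.mem_of_mem_erase hQ) (Finset.ne_of_mem_erase hQ).symm)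
        hqP hqQ
    -- The cutoff is locally constant near both closed sets, not merely on them, so derivatives of
    -- `ψ` never enter the gradient or the Hessian on the pieces.
    obtain ⟨ψ, hψ0, hψ1, -⟩ := exists_contMDiffMap_zero_one_nhds_of_isClosed (𝓡∂ (n + 1)) (n := (⊤ : ℕ∞))
      (hZc.union hO.isClosed_compl) (ht P hP).isClosed hdisj
    rw [eventually_nhdsSet_iff_forall] at hψ0 hψ1
    have hzero (q : M) (hq : q ∈ (⋃ Q ∈ t.erase P, Q.2) ∪ Oᶜ) :
        (fun z => ψ z * f z) =ᶠ[𝓝 q] 0 := by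
      filter_upwards [hψ0 q hq] with z hz
      simp [hz]
    refine ⟨fun z => ψ z * f z, c, hc, fun q => ?_, fun q hq => ?_, fun Q hQ hne q hq => ?_⟩
    · by_cases hq : q ∈ O
      · exact (ψ.contMDiff q).mul (hf.contMDiffAt (hO.mem_nhds hq))
      · exact contMDiffAt_const.congr_of_eventuallyEq (hzero q (Or.inr hq))
    · refine (hconv q hq).congr ?_
      filter_upwards [hψ1 q hq] with z hz
      simp [hz]
    · exact hzero q (Or.inl (mem_iUnion₂.2 ⟨Q, Finset.mem_erase.2 ⟨hne, hQ⟩, hq⟩))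
  choose! h c hc hsm hconv hzero using hex
  obtain ⟨c₀, hc₀, hle⟩ : ∃ c₀ > 0, ∀ P ∈ t, c₀ ≤ c P := by
    rcases t.eq_empty_or_nonempty with rfl | hne
    · exact ⟨1, one_pos, by simp⟩
    · exact ⟨t.inf' hne c, (Finset.lt_inf'_iff hne).2 hc, fun P hP => Finset.inf'_le c hP⟩
  refine ⟨fun z => ∑ P ∈ t, h P z, contMDiff_finsetSum fun P hP => hsm P hP, c₀, hc₀,
    fun q hq => ?_⟩
  obtain ⟨P, hP, hqP⟩ := mem_iUnion₂.1 hq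
  refine ((hconv P hP q hqP).mono (hle P hP)).congr ?_
  have hall : ∀ᶠ z in 𝓝 q, ∀ Q ∈ t.erase P, h Q z = 0 := by
    refine (Filter.eventually_all_finset _).2 fun Q hQ => ?_
    exact hzero Q (Finset.mem_of_mem_erase hQ) P hP (Finset.ne_of_mem_erase hQ).symm q hqP
  filter_upwards [hall] with z hz
  rw [← Finset.add_sum_erase t _ hP, Finset.sum_eq_zero hz, add_zero]

end Assembly

end RiemBdry

end

/-! ### The main theorem -/

theorem mainTheorem4 (n : ℕ) {M : Type*} [TopologicalSpace M] [T2Space M] [CompactSpace M]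
    [ConnectedSpace M] [ChartedSpace (EuclideanHalfSpace (n + 1)) M]
    [IsManifold (𝓡∂ (n + 1)) ∞ M] [MeasurableSpace M] [BorelSpace M]
    (g : RiemBdry.Metric n M) (ε ε₀ : ℝ) (hε₀ : 0 < ε₀) (hε : ε₀ < ε) :
    ∃ V : Set M, IsOpen V ∧
      RiemBdry.HasSmoothTransversalBoundary n V ∧
      RiemBdry.Controllable g ε₀ (closure Vᶜ) ∧
      (∃ d : M → ℝ,
        ContMDiff (𝓡∂ (n + 1)) 𝓘(ℝ, ℝ) ∞ d ∧
        (∀ x ∈ closure V, ∀ X : TangentSpace (𝓡∂ (n + 1)) x,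
          RiemBdry.tangentNorm g X ^ 2 ≤ RiemBdry.hessian g d x X X) ∧
        (∃ c > 0, ∀ x ∈ V, c ≤ RiemBdry.tangentNorm g (RiemBdry.gradient g d x)) ∧
        (∃ x₀ ∈ closure V, IsMinOn d (closure V) x₀ ∧ 0 < d x₀) ∧
        (∀ x ∈ (𝓡∂ (n + 1)).boundary M ∩ closure V,
          g.inner x (RiemBdry.gradient g d x) (RiemBdry.outwardNormal g x) < 0)) ∧
      (∃ W : Set M, IsOpen W ∧
        RiemBdry.Controllable g ε W ∧
        closure Vᶜ ⊆ W ∧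
        RiemBdry.Controllable g (ε - ε₀) (W ∩ V)) := by
  classical
  have : SecondCountableTopology (EuclideanHalfSpace (n + 1)) :=
    inferInstanceAs (SecondCountableTopology {y : EuclideanSpace ℝ (Fin (n + 1)) // 0 ≤ y 0})
  have : SecondCountableTopology M :=
    ChartedSpace.secondCountable_of_sigmaCompact (EuclideanHalfSpace (n + 1)) M
  have : TopologicalSpace.MetrizableSpace M := TopologicalSpace.metrizableSpace_of_t3_secondCountable M
  have := RiemBdry.isFiniteMeasure_volumeMeasure g
  have := RiemBdry.isFiniteMeasure_boundaryMeasure g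
  have : IsManifold (𝓡∂ (n + 1)) 1 M := IsManifold.of_le (n := ∞) (by simp)
  obtain ⟨z₀⟩ : Nonempty M := inferInstance
  have hbd : MeasurableSet ((𝓡∂ (n + 1)).boundary M) :=
    ((𝓡∂ (n + 1)).isClosed_boundary (n := 1) one_ne_zero).measurableSet
  -- One measure controls both parts of the condition. The Dirac mass makes `ν univ ≥ 1`, so the
  -- bound `ν Vᶜ < 1` below rules out `V = ∅` without proving that the volume is positive.
  set ν : Measure M := RiemBdry.volumeMeasure g +
    (RiemBdry.boundaryMeasure g).restrict ((𝓡∂ (n + 1)).boundary M) + Measure.dirac z₀ with hν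
  have hle (A : Set M) : RiemBdry.volumeMeasure g A +
      RiemBdry.boundaryMeasure g (A ∩ (𝓡∂ (n + 1)).boundary M) ≤ ν A := by
    rw [hν, Measure.add_apply, Measure.add_apply, Measure.restrict_apply' hbd]
    exact le_self_add
  obtain ⟨t, ht, htν⟩ := RiemBdry.exists_isFamily_compl g ν
    (δ := min (ENNReal.ofReal ε₀) 1) (by simp [hε₀])
  set V := ⋃ P ∈ t, P.1 with hV
  have hVo : IsOpen V := isOpen_biUnion fun P hP => (ht.isPiece P hP).isOpen
  have hVc : closure Vᶜ = Vᶜ := hVo.isClosed_compl.closure_eq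
  have hVne : V.Nonempty := by
    rw [Set.nonempty_iff_ne_empty]
    intro h0
    have h1 : ν Vᶜ < 1 := htν.trans_le (min_le_right _ _)
    rw [h0, Set.compl_empty] at h1
    refine h1.not_ge ?_
    rw [hν, Measure.add_apply, Measure.dirac_apply_of_mem (Set.mem_univ z₀)]
    exact le_add_self
  have hνV : ν Vᶜ < ENNReal.ofReal ε₀ := htν.trans_le (min_le_left _ _)
  have hVcl := RiemBdry.closure_biUnion_subset ht.isPiece
  refine ⟨V, hVo, RiemBdry.hasSmoothTransversalBoundary_biUnion ht.isPiece ht.pairwiseDisjoint,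
    ⟨isClosed_closure.measurableSet, ?_⟩, ?_, ?_⟩
  · rw [hVc]
    exact (hle _).trans_lt hνV
  · obtain ⟨d, hd, c, hc, hconv⟩ :=
      RiemBdry.exists_isConvexAt_biUnion ht.isPiece ht.pairwiseDisjoint
    refine ⟨d, hd, fun x hx => (hconv x (hVcl hx)).sq_le_hessian,
      ⟨c, hc, fun x hx => (hconv x (hVcl (subset_closure hx))).le_gradient⟩, ?_,
      fun x hx => (hconv x (hVcl hx.2)).inner_lt hx.1⟩
    obtain ⟨x₀, hx₀, hmin⟩ := isClosed_closure.isCompact.exists_isMinOn hVne.closure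
      hd.continuous.continuousOn
    exact ⟨x₀, hx₀, hmin, one_pos.trans_le (hconv x₀ (hVcl hx₀)).one_le⟩
  -- Outer regularity gives an open `W ⊇ Vᶜ` whose excess `W \ Vᶜ = W ∩ V` has measure below `ε -
  -- ε₀`; adding `ν Vᶜ < ε₀` bounds `W` by `ε`.
  · obtain ⟨W, hVW, hW, -, hνW⟩ := hVo.isClosed_compl.measurableSet.exists_isOpen_sdiff_lt
      (measure_ne_top ν _) (ε := ENNReal.ofReal (ε - ε₀)) (by simp [hε])
    rw [Set.sdiff_eq, compl_compl] at hνW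
    refine ⟨W, hW, ⟨hW.measurableSet, ?_⟩, by rw [hVc]; exact hVW, (hW.inter hVo).measurableSet,
      (hle _).trans_lt hνW⟩
    refine (hle W).trans_lt ?_
    calc ν W ≤ ν (Vᶜ ∪ W ∩ V) := measure_mono fun q hq => by
          by_cases h : q ∈ V
          · exact Or.inr ⟨hq, h⟩
          · exact Or.inl h
      _ ≤ ν Vᶜ + ν (W ∩ V) := measure_union_le _ _
      _ < ENNReal.ofReal ε₀ + ENNReal.ofReal (ε - ε₀) := ENNReal.add_lt_add hνV hνW
      _ = ENNReal.ofReal ε := by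
          rw [← ENNReal.ofReal_add hε₀.le (sub_pos.2 hε).le, add_sub_cancel]
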